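/- Let $(T,\Sigma,\mu)$ be a non-atomic, $\sigma$-finite measure space, and let $\Phi\colon T\times[0,\infty]\to[0,\infty]$ be a Musielak--Orlicz function: for $\mu$-a.e. $t\in T$, $\Phi(t,\cdot)$ is convex and lower semi-continuous with $\Phi(t,0)=\lim_{u\downarrow 0}\Phi(t,u)=0$ and $\Phi(t,\infty)=\infty$, and $\Phi(\cdot,u)$ is $\mu$-measurable for every $u\in[0,\infty]$. No further condition (finiteness, growth, $\Delta_2$) is imposed on $\Phi$. Let $\Phi^*(t,v)=\sup_{0<u<\infty}(uv-\Phi(t,u))$ be its complementary function. For a real-valued measurable function $u$ on $T$ (identified $\mu$-a.e.) and $\Psi\in\{\Phi,\Phi^*\}$ put $I_\Psi(u)=\int_T\Psi(t,|u(t)|)\,d\mu$ and $L^\Psi=\{u: I_\Psi(\lambda u)<\infty\text{ for some }\lambda>0\}$. Let $L_0^\Phi$ be $L^\Phi$ equipped with the Orlicz norm $\|u\|_{\Phi,0}=\sup\{|\int_T uv\,d\mu| : I_{\Phi^*}(v)\le 1\}$, and let $(L_0^\Phi)^*$ be its topological dual with the norm $\|f\|=\sup_{u\ne0}|f(u)|/\|u\|_{\Phi,0}$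 (equal to $0$ if $L^\Phi=\{0\}$). For $v\in L^{\Phi^*}$ write $f_v(u)=\int_T uv\,d\mu$. A functional $g\in(L_0^\Phi)^*$ is called purely singular if the order continuous component of its modulus vanishes: for every $u\ge 0$ in $L^\Phi$, $$\inf\Bigl\{\sup_{n}|g|(u_n) : u_n\in L^\Phi,\ 0\le u_n\uparrow u\Bigr\}=0,\qquad |g|(x)=\sup\{|g(w)| : w\in L^\Phi,\ |w|\le x\}\quad(x\ge0).$$ **Proposition.** Let $f=f_v+f_{\mathrm s}\in(L_0^\Phi)^*$, where $v\in L^{\Phi^*}$ and $f_{\mathrm s}\in(L_0^\Phi)^*$ is purely singular. Then the set $\{\lambda>0: I_{\Phi^*}(v/\lambda)+\|f_{\mathrm s}/\lambda\|\le 1\}$ is non-empty and $$\|f\|=\inf\{\lambda>0: I_{\Phi^*}(v/\lambda)+\|f_{\mathrm s}/\lambda\|\le 1\}.$$ -/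

import Mathlib

open MeasureTheory Filter Topology
open scoped ENNReal NNReal

namespace MusielakOrlicz

/-- The complementary function `Φ*(t, v) = sup {u v - Φ(t, u) : 0 < u < ∞}`. The subtraction is
truncated at `0`, which does not change the supremum: `u v - Φ(t, u)` tends to `0` as `u ↓ 0`. -/
noncomputable def conj {T : Type*} (Φ : T → ℝ≥0∞ → ℝ≥0∞) (t : T) (v : ℝ≥0∞) : ℝ≥0∞ :=
  ⨆ (u : ℝ≥0∞) (_ : 0 < u) (_ : u < ∞), (u * v - Φ t u)

theorem conj_zero {T : Type*} (Φ : T → ℝ≥0∞ → ℝ≥0∞) (t : T) : conj Φ t 0 = 0 := by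
  simp [conj]

variable {T : Type*} [MeasurableSpace T]

/-- A measure is non-atomic if every measurable set of positive measure splits into two measurable
parts of positive measure. -/
def IsNonatomic (μ : Measure T) : Prop :=
  ∀ A : Set T, MeasurableSet A → 0 < μ A →
    ∃ B : Set T, MeasurableSet B ∧ B ⊆ A ∧ 0 < μ B ∧ 0 < μ (A \ B)

/-- The space `L⁰` of real-valued measurable functions, with equality almost everywhere, is
`T →ₘ[μ] ℝ`. The functional `I_Φ(u) = ∫ Φ(t, |u(t)|) dμ`, with values in `[0, ∞]`. -/
noncomputable def modular (μ : Measure T) (Φ : T → ℝ≥0∞ → ℝ≥0∞) (u : T →ₘ[μ] ℝ) : ℝ≥0∞ :=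
  ∫⁻ t, Φ t (ENNReal.ofReal |u t|) ∂μ

/-- Membership in `L^Φ`: `I_Φ(lam u) < ∞` for some `lam > 0`. -/
def MemSpace (μ : Measure T) (Φ : T → ℝ≥0∞ → ℝ≥0∞) (u : T →ₘ[μ] ℝ) : Prop :=
  ∃ lam : ℝ, 0 < lam ∧ modular μ Φ (lam • u) < ∞

/-- Musielak--Orlicz functions `Φ : T × [0, ∞] → [0, ∞]`. -/
structure MusielakOrliczFunction (μ : Measure T) where
  toFun : T → ℝ≥0∞ → ℝ≥0∞
  convexOn : ∀ᵐ t ∂μ, ConvexOn ℝ≥0 Set.univ (toFun t)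
  lowerSemicontinuous : ∀ᵐ t ∂μ, LowerSemicontinuous (toFun t)
  map_zero : ∀ᵐ t ∂μ, toFun t 0 = 0
  tendsto_zero : ∀ᵐ t ∂μ, Tendsto (toFun t) (𝓝[>] 0) (𝓝 0)
  map_top : ∀ᵐ t ∂μ, toFun t ∞ = ∞
  aemeasurable : ∀ u : ℝ≥0∞, AEMeasurable (fun t => toFun t u) μ

variable {μ : Measure T}

namespace MusielakOrliczFunction

theorem map_smul_le (Φ : MusielakOrliczFunction μ) :
    ∀ᵐ t ∂μ, ∀ (c : ℝ≥0) (x : ℝ≥0∞), c ≤ 1 → Φ.toFun t (c * x) ≤ c * Φ.toFun t x := by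
  filter_upwards [Φ.convexOn, Φ.map_zero] with t h1 h0 c x hc
  have := h1.2 (Set.mem_univ x) (Set.mem_univ 0) (zero_le (a := c)) (zero_le (a := 1 - c))
    (add_tsub_cancel_of_le hc)
  simpa [h0, ENNReal.smul_def] using this

theorem monotone (Φ : MusielakOrliczFunction μ) : ∀ᵐ t ∂μ, Monotone (Φ.toFun t) := by
  filter_upwards [Φ.map_smul_le, Φ.map_top] with t h1 htop x y hxy
  rcases eq_or_ne y ∞ with rfl | hy
  · simp [htop]
  rcases eq_or_ne y 0 with rfl | hy0
  · simp [le_antisymm hxy (zero_le)]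
  lift y to ℝ≥0 using hy
  lift x to ℝ≥0 using ne_top_of_le_ne_top ENNReal.coe_ne_top hxy
  have hxy' : x ≤ y := by exact_mod_cast hxy
  have hy0' : y ≠ 0 := by exact_mod_cast hy0
  have hc : x / y ≤ 1 := div_le_one_of_le₀ hxy' (zero_le)
  have h := h1 (x / y) y hc
  rw [← ENNReal.coe_mul, div_mul_cancel₀ _ hy0'] at h
  refine h.trans ?_
  calc ((x / y : ℝ≥0) : ℝ≥0∞) * Φ.toFun t y ≤ 1 * Φ.toFun t y := by
        gcongr; exact_mod_cast hc
    _ = _ := one_mul _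

theorem aemeasurable_comp (Φ : MusielakOrliczFunction μ) {u : T → ℝ≥0∞} (hu : AEMeasurable u μ) :
    AEMeasurable (fun t => Φ.toFun t (u t)) μ := by
  have key : (fun t => Φ.toFun t (u t)) =ᵐ[μ]
      fun t => ⨆ q : ℚ, Set.indicator {t | ENNReal.ofReal (q : ℝ) < hu.mk u t}
        (fun t => (Φ.aemeasurable (ENNReal.ofReal (q : ℝ))).mk _ t) t := by
    have hq : ∀ᵐ t ∂μ, ∀ q : ℚ, Φ.toFun t (ENNReal.ofReal (q : ℝ)) =
        (Φ.aemeasurable (ENNReal.ofReal (q : ℝ))).mk _ t :=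
      ae_all_iff.2 fun q => (Φ.aemeasurable (ENNReal.ofReal (q : ℝ))).ae_eq_mk
    filter_upwards [hq, hu.ae_eq_mk, Φ.monotone, Φ.lowerSemicontinuous, Φ.map_zero]
      with t h1 h2 hm hl h0
    simp only [Set.indicator_apply, Set.mem_ofPred_eq, ← h1, ← h2]
    apply le_antisymm
    · rcases eq_or_ne (u t) 0 with hz | hz
      · simp [hz, h0]
      refine le_of_forall_lt fun y hy => ?_
      have hev := hl (u t) y hy
      obtain ⟨l, hl1, hl2⟩ := exists_Ioc_subset_of_mem_nhds hev ⟨0, pos_iff_ne_zero.2 hz⟩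
      obtain ⟨q, hq0, hq1, hq2⟩ := ENNReal.lt_iff_exists_rat_btwn.1 hl1
      refine lt_of_lt_of_le (hl2 ⟨hq1, hq2.le⟩) ?_
      refine le_trans ?_ (le_iSup _ q)
      rw [if_pos (show ENNReal.ofReal (q : ℝ) < u t from hq2)]
      exact le_rfl
    · refine iSup_le fun q => ?_
      split_ifs with h
      · exact hm h.le
      · exact zero_le
  refine AEMeasurable.congr (Measurable.aemeasurable ?_) key.symm
  refine Measurable.iSup fun q => Measurable.indicator ?_ ?_
  · exact (Φ.aemeasurable _).measurable_mk
  · exact measurableSet_lt measurable_const hu.measurable_mk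

theorem aemeasurable_abs (Φ : MusielakOrliczFunction μ) (u : T →ₘ[μ] ℝ) :
    AEMeasurable (fun t => Φ.toFun t (ENNReal.ofReal |u t|)) μ :=
  Φ.aemeasurable_comp (by
    have := u.aestronglyMeasurable.aemeasurable
    exact (continuous_abs.measurable.comp_aemeasurable this).ennreal_ofReal)

theorem modular_zero (Φ : MusielakOrliczFunction μ) : modular μ Φ.toFun 0 = 0 := by
  unfold modular
  rw [lintegral_eq_zero_iff' (Φ.aemeasurable_abs 0)]
  filter_upwards [Φ.map_zero, AEEqFun.coeFn_zero (α := T) (μ := μ) (β := ℝ)] with t h0 h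
  simp [h, h0]

theorem modular_le (Φ : MusielakOrliczFunction μ) {u v : T →ₘ[μ] ℝ}
    (h : ∀ᵐ t ∂μ, |u t| ≤ |v t|) : modular μ Φ.toFun u ≤ modular μ Φ.toFun v := by
  refine lintegral_mono_ae ?_
  filter_upwards [Φ.monotone, h] with t hm h
  exact hm (ENNReal.ofReal_le_ofReal h)

/-- The Musielak--Orlicz space `L^Φ` as a subspace of `L⁰`. -/
def space (Φ : MusielakOrliczFunction μ) : Submodule ℝ (T →ₘ[μ] ℝ) where
  carrier := {u | MemSpace μ Φ.toFun u}
  zero_mem' := ⟨1, one_pos, by simp [Φ.modular_zero]⟩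
  add_mem' := by
    rintro u v ⟨a, ha, hu⟩ ⟨b, hb, hv⟩
    refine ⟨min a b / 2, by positivity, ?_⟩
    refine lt_of_le_of_lt ?_ (ENNReal.add_lt_top.2 ⟨hu, hv⟩)
    unfold modular
    rw [← lintegral_add_left' (Φ.aemeasurable_abs _)]
    refine lintegral_mono_ae ?_
    filter_upwards [Φ.monotone, Φ.convexOn, AEEqFun.coeFn_smul (min a b / 2) (u + v),
      AEEqFun.coeFn_add u v, AEEqFun.coeFn_smul a u, AEEqFun.coeFn_smul b v]
      with t hm hc e1 e2 e3 e4
    rw [e1, e3, e4]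
    simp only [Pi.smul_apply, e2, Pi.add_apply, smul_eq_mul]
    have h2 : ((1 / 2 : ℝ≥0) : ℝ≥0) + 1 / 2 = 1 := by
      ext; push_cast; norm_num
    have hconv := hc.2 (Set.mem_univ (ENNReal.ofReal |a * u t|))
      (Set.mem_univ (ENNReal.ofReal |b * v t|)) (zero_le (a := (1 / 2 : ℝ≥0)))
      (zero_le (a := (1 / 2 : ℝ≥0))) h2
    have hle : ENNReal.ofReal |min a b / 2 * (u t + v t)| ≤
        (1 / 2 : ℝ≥0) • ENNReal.ofReal |a * u t| + (1 / 2 : ℝ≥0) • ENNReal.ofReal |b * v t| := by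
      have e : ((1 / 2 : ℝ≥0) : ℝ≥0∞) = ENNReal.ofReal (1 / 2) := by
        rw [ENNReal.ofReal]; congr 1; ext; simp
      rw [ENNReal.smul_def, ENNReal.smul_def, e, smul_eq_mul, smul_eq_mul,
        ← ENNReal.ofReal_mul (by norm_num), ← ENNReal.ofReal_mul (by norm_num),
        ← ENNReal.ofReal_add (by positivity) (by positivity)]
      apply ENNReal.ofReal_le_ofReal
      rw [abs_mul, abs_mul a, abs_mul b, abs_of_pos ha, abs_of_pos hb,
        abs_of_pos (show (0 : ℝ) < min a b / 2 by positivity)]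
      have h1 : min a b * |u t| ≤ a * |u t| := by gcongr; exact min_le_left _ _
      have h2 : min a b * |v t| ≤ b * |v t| := by gcongr; exact min_le_right _ _
      have h3 : min a b / 2 * |u t + v t| ≤ min a b / 2 * (|u t| + |v t|) := by
        gcongr; exact abs_add_le _ _
      linarith
    refine (hm hle).trans (hconv.trans ?_)
    have hhalf : ∀ x : ℝ≥0∞, (1 / 2 : ℝ≥0) • x ≤ x := fun x => by
      rw [ENNReal.smul_def, smul_eq_mul]
      calc ((1 / 2 : ℝ≥0) : ℝ≥0∞) * x ≤ 1 * x := by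
            gcongr
            exact_mod_cast le_trans le_self_add h2.le
        _ = x := one_mul x
    exact add_le_add (hhalf _) (hhalf _)
  smul_mem' := by
    rintro c u ⟨a, ha, hu⟩
    rcases eq_or_ne c 0 with rfl | hc
    · exact ⟨1, one_pos, by simp [Φ.modular_zero]⟩
    refine ⟨a / |c|, by positivity, lt_of_le_of_lt (Φ.modular_le ?_) hu⟩
    filter_upwards [AEEqFun.coeFn_smul (a / |c|) (c • u), AEEqFun.coeFn_smul c u,
      AEEqFun.coeFn_smul a u] with t e1 e2 e3
    rw [e1, e3]
    simp only [Pi.smul_apply, e2, smul_eq_mul]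
    rw [← mul_assoc, abs_mul, abs_mul a, abs_mul (a / |c|), abs_div, abs_abs,
      div_mul_cancel₀ _ (abs_ne_zero.2 hc)]

/-- Young's inequality. -/
theorem young (Φ : MusielakOrliczFunction μ) (t : T) (u v : ℝ) :
    ENNReal.ofReal |u * v| ≤
      Φ.toFun t (ENNReal.ofReal |u|) + conj Φ.toFun t (ENNReal.ofReal |v|) := by
  rcases eq_or_ne u 0 with rfl | hu
  · simp
  rw [abs_mul, ENNReal.ofReal_mul (abs_nonneg u), ← tsub_le_iff_left]
  exact le_iSup_of_le (ENNReal.ofReal |u|) (le_iSup_of_le (by simpa using hu)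
    (le_iSup_of_le ENNReal.ofReal_lt_top le_rfl))

theorem lintegral_mul_le (Φ : MusielakOrliczFunction μ) (u v : T →ₘ[μ] ℝ) :
    ∫⁻ t, ENNReal.ofReal |u t * v t| ∂μ ≤ modular μ Φ.toFun u + modular μ (conj Φ.toFun) v := by
  unfold modular
  rw [← lintegral_add_left' (Φ.aemeasurable_abs u)]
  exact lintegral_mono fun t => Φ.young t _ _

theorem integrable_mul (Φ : MusielakOrliczFunction μ) {u v : T →ₘ[μ] ℝ}
    (hu : MemSpace μ Φ.toFun u) (hv : MemSpace μ (conj Φ.toFun) v) :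
    Integrable (fun t => u t * v t) μ := by
  obtain ⟨a, ha, hu⟩ := hu
  obtain ⟨b, hb, hv⟩ := hv
  have h : Integrable (fun t => (a • u) t * (b • v) t) μ := by
    refine ⟨(a • u).aestronglyMeasurable.mul (b • v).aestronglyMeasurable, ?_⟩
    rw [hasFiniteIntegral_iff_norm]
    exact lt_of_le_of_lt (Φ.lintegral_mul_le _ _) (ENNReal.add_lt_top.2 ⟨hu, hv⟩)
  have h' := h.const_mul (a⁻¹ * b⁻¹)
  refine h'.congr ?_
  filter_upwards [AEEqFun.coeFn_smul a u, AEEqFun.coeFn_smul b v] with t e1 e2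
  simp only [e1, e2, Pi.smul_apply, smul_eq_mul]
  field_simp

theorem memSpace_of_modular_le_one {Φ : T → ℝ≥0∞ → ℝ≥0∞} {v : T →ₘ[μ] ℝ}
    (hv : modular μ Φ v ≤ 1) : MemSpace μ Φ v :=
  ⟨1, one_pos, by rw [one_smul]; exact hv.trans_lt ENNReal.one_lt_top⟩

/-- The numbers `|∫ u v dμ|`, where `v` runs over the functions with `I_{Φ*}(v) ≤ 1`. -/
def orliczSet (Φ : MusielakOrliczFunction μ) (u : T →ₘ[μ] ℝ) : Set ℝ :=
  {r | ∃ v : T →ₘ[μ] ℝ, modular μ (conj Φ.toFun) v ≤ 1 ∧ r = |∫ t, u t * v t ∂μ|}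

/-- The Orlicz norm `‖u‖_{Φ,0} = sup {|∫ u v dμ| : I_{Φ*}(v) ≤ 1}`. -/
noncomputable def orliczNorm (Φ : MusielakOrliczFunction μ) (u : T →ₘ[μ] ℝ) : ℝ :=
  sSup (Φ.orliczSet u)

theorem orliczSet_nonempty (Φ : MusielakOrliczFunction μ) (u : T →ₘ[μ] ℝ) :
    (Φ.orliczSet u).Nonempty := by
  refine ⟨_, 0, ?_, rfl⟩
  unfold modular
  rw [lintegral_congr_ae (g := fun _ => 0)]
  · simp
  · filter_upwards [AEEqFun.coeFn_zero (α := T) (μ := μ) (β := ℝ)] with t h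
    simp [h, conj_zero]

theorem orliczSet_bddAbove (Φ : MusielakOrliczFunction μ) {u : T →ₘ[μ] ℝ}
    (hu : MemSpace μ Φ.toFun u) : BddAbove (Φ.orliczSet u) := by
  obtain ⟨a, ha, hu⟩ := hu
  refine ⟨a⁻¹ * (modular μ Φ.toFun (a • u) + 1).toReal, ?_⟩
  rintro r ⟨v, hv, rfl⟩
  have e : ∫ t, u t * v t ∂μ = a⁻¹ * ∫ t, (a • u) t * v t ∂μ := by
    rw [← integral_const_mul]
    refine integral_congr_ae ?_
    filter_upwards [AEEqFun.coeFn_smul a u] with t e1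
    simp only [e1, Pi.smul_apply, smul_eq_mul]
    field_simp
  rw [e, abs_mul, abs_of_pos (inv_pos.2 ha)]
  gcongr
  have h1 := norm_integral_le_lintegral_norm (μ := μ) (fun t => (a • u) t * v t)
  rw [Real.norm_eq_abs] at h1
  refine h1.trans (ENNReal.toReal_mono (ENNReal.add_ne_top.2 ⟨hu.ne, ENNReal.one_ne_top⟩) ?_)
  exact (Φ.lintegral_mul_le _ _).trans (by gcongr)

theorem le_orliczNorm (Φ : MusielakOrliczFunction μ) {u v : T →ₘ[μ] ℝ}
    (hu : MemSpace μ Φ.toFun u) (hv : modular μ (conj Φ.toFun) v ≤ 1) :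
    |∫ t, u t * v t ∂μ| ≤ Φ.orliczNorm u :=
  le_csSup (Φ.orliczSet_bddAbove hu) ⟨v, hv, rfl⟩

theorem orliczNorm_zero (Φ : MusielakOrliczFunction μ) : Φ.orliczNorm 0 = 0 := by
  have h : Φ.orliczSet (0 : T →ₘ[μ] ℝ) = {0} := by
    refine (Φ.orliczSet_nonempty 0).subset_singleton_iff.1 ?_
    rintro r ⟨v, -, rfl⟩
    rw [integral_congr_ae (g := fun _ => 0)]
    · simp
    · filter_upwards [AEEqFun.coeFn_zero (α := T) (μ := μ) (β := ℝ)] with t h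
      simp [h]
  rw [orliczNorm, h, csSup_singleton]

theorem orliczNorm_add_le (Φ : MusielakOrliczFunction μ) {u w : T →ₘ[μ] ℝ}
    (hu : MemSpace μ Φ.toFun u) (hw : MemSpace μ Φ.toFun w) :
    Φ.orliczNorm (u + w) ≤ Φ.orliczNorm u + Φ.orliczNorm w := by
  refine csSup_le (Φ.orliczSet_nonempty _) ?_
  rintro r ⟨v, hv, rfl⟩
  have hv' := memSpace_of_modular_le_one hv
  have e : ∫ t, (u + w) t * v t ∂μ = ∫ t, u t * v t ∂μ + ∫ t, w t * v t ∂μ := by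
    rw [← integral_add (Φ.integrable_mul hu hv') (Φ.integrable_mul hw hv')]
    refine integral_congr_ae ?_
    filter_upwards [AEEqFun.coeFn_add u w] with t e
    simp only [e, Pi.add_apply, add_mul]
  rw [e]
  exact (abs_add_le _ _).trans (add_le_add (Φ.le_orliczNorm hu hv) (Φ.le_orliczNorm hw hv))

theorem integral_smul_mul (c : ℝ) (u v : T →ₘ[μ] ℝ) :
    ∫ t, (c • u) t * v t ∂μ = c * ∫ t, u t * v t ∂μ := by
  rw [← integral_const_mul]
  refine integral_congr_ae ?_
  filter_upwards [AEEqFun.coeFn_smul c u] with t e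
  simp only [e, Pi.smul_apply, smul_eq_mul, mul_assoc]

open scoped Pointwise in
theorem orliczNorm_smul (Φ : MusielakOrliczFunction μ) (c : ℝ) (u : T →ₘ[μ] ℝ) :
    Φ.orliczNorm (c • u) = |c| * Φ.orliczNorm u := by
  have h : Φ.orliczSet (c • u) = |c| • Φ.orliczSet u := by
    ext r
    simp only [orliczSet, Set.mem_smul_set, Set.mem_ofPred_eq, integral_smul_mul, abs_mul,
      smul_eq_mul]
    constructor
    · rintro ⟨v, hv, rfl⟩
      exact ⟨_, ⟨v, hv, rfl⟩, rfl⟩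
    · rintro ⟨_, ⟨v, hv, rfl⟩, rfl⟩
      exact ⟨v, hv, rfl⟩
  rw [orliczNorm, h, Real.sSup_smul_of_nonneg (abs_nonneg c), smul_eq_mul, orliczNorm]

theorem conj_le (Φ : MusielakOrliczFunction μ) :
    ∀ᵐ t ∂μ, ∀ (m : ℝ≥0) (c : ℝ≥0∞), 0 < m → 1 ≤ Φ.toFun t m → c ≤ (m⁻¹ : ℝ≥0) →
      conj Φ.toFun t c ≤ m * c := by
  filter_upwards [Φ.map_smul_le] with t hs m c hm h1 hc
  refine iSup_le fun x => iSup_le fun hx0 => iSup_le fun hx => ?_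
  lift x to ℝ≥0 using hx.ne
  rcases le_total x m with hxm | hxm
  · exact tsub_le_self.trans (by gcongr)
  · have hx0' : 0 < x := by exact_mod_cast hx0
    have h := hs (m / x) x (div_le_one_of_le₀ hxm zero_le)
    rw [← ENNReal.coe_mul, div_mul_cancel₀ _ hx0'.ne'] at h
    have h2 : (x : ℝ≥0∞) * (m⁻¹ : ℝ≥0) ≤ Φ.toFun t x := by
      calc (x : ℝ≥0∞) * (m⁻¹ : ℝ≥0) = (x / m : ℝ≥0) * 1 := by
            rw [← ENNReal.coe_mul, mul_one, div_eq_mul_inv]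
        _ ≤ (x / m : ℝ≥0) * ((m / x : ℝ≥0) * Φ.toFun t x) := by gcongr; exact h1.trans h
        _ = Φ.toFun t x := by
            rw [← mul_assoc, ← ENNReal.coe_mul, div_mul_div_cancel₀ hm.ne', div_self hx0'.ne']
            simp
    have h3 : (x : ℝ≥0∞) * c - Φ.toFun t x = 0 :=
      tsub_eq_zero_of_le (le_trans (by gcongr) h2)
    rw [h3]
    exact zero_le

theorem eq_zero_of_orliczNorm_eq_zero [SigmaFinite μ] (Φ : MusielakOrliczFunction μ)
    {u : T →ₘ[μ] ℝ} (hu : MemSpace μ Φ.toFun u) (h0 : Φ.orliczNorm u = 0) : u = 0 := by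
  have hmeas : ∀ n : ℕ, AEMeasurable (fun t => Φ.toFun t ((n + 1 : ℕ) : ℝ≥0∞)) μ :=
    fun n => Φ.aemeasurable _
  set A : ℕ → Set T := fun n => spanningSets μ n ∩ {t | 1 ≤ (hmeas n).mk _ t} with hA
  have hAm : ∀ n, MeasurableSet (A n) := fun n =>
    (measurableSet_spanningSets μ n).inter
      (measurableSet_le measurable_const (hmeas n).measurable_mk)
  have hAfin : ∀ n, μ (A n) < ∞ := fun n =>
    lt_of_le_of_lt (measure_mono Set.inter_subset_left) (measure_spanningSets_lt_top μ n)
  have hkey : ∀ n, ∀ᵐ t ∂μ, t ∈ A n → u t = 0 := by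
    intro n
    set m : ℝ≥0 := ((n + 1 : ℕ) : ℝ≥0) with hm
    have hmpos : 0 < m := by rw [hm]; positivity
    set M : ℝ≥0 := (μ (A n)).toNNReal with hM
    have hMe : (M : ℝ≥0∞) = μ (A n) := ENNReal.coe_toNNReal (hAfin n).ne
    set c : ℝ≥0 := m⁻¹ * (1 + M)⁻¹ with hc
    have hcpos : 0 < c := by positivity
    have hcm : c ≤ m⁻¹ := by
      rw [hc]
      exact mul_le_of_le_one_right zero_le (inv_le_one_of_one_le₀ le_self_add)
    have hum : AEMeasurable u μ := u.aestronglyMeasurable.aemeasurable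
    set v₀ : T → ℝ := (A n).indicator (fun t => if 0 ≤ u t then (c : ℝ) else -(c : ℝ)) with hv₀
    have hv₀m : AEStronglyMeasurable v₀ μ := by
      have hms : Measurable fun x : ℝ => if 0 ≤ x then (c : ℝ) else -(c : ℝ) :=
        Measurable.ite measurableSet_Ici measurable_const measurable_const
      exact ((hms.comp_aemeasurable hum).indicator (hAm n)).aestronglyMeasurable
    set v : T →ₘ[μ] ℝ := AEEqFun.mk v₀ hv₀m with hv
    have hve : v =ᵐ[μ] v₀ := AEEqFun.coeFn_mk _ _
    have hv1 : modular μ (conj Φ.toFun) v ≤ 1 := by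
      calc modular μ (conj Φ.toFun) v
          ≤ ∫⁻ t, (A n).indicator (fun _ => (m * c : ℝ≥0∞)) t ∂μ := by
            refine lintegral_mono_ae ?_
            filter_upwards [Φ.conj_le, hve, (hmeas n).ae_eq_mk] with t h1 h2 h3
            rw [h2]
            by_cases ht : t ∈ A n
            · have habs : |v₀ t| = c := by
                simp only [hv₀, Set.indicator_of_mem ht]
                split_ifs <;> simp
              rw [habs, Set.indicator_of_mem ht, ENNReal.ofReal_coe_nnreal]
              refine h1 m c hmpos ?_ (by exact_mod_cast hcm)
              have := ht.2
              simp only [Set.mem_ofPred_eq, ← h3] at this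
              simpa [hm] using this
            · simp [hv₀, Set.indicator_of_notMem ht, conj_zero]
        _ = m * c * μ (A n) := by rw [lintegral_indicator_const (hAm n)]
        _ ≤ 1 := by
            rw [← hMe, ← ENNReal.coe_mul, ← ENNReal.coe_mul, hc, ← mul_assoc,
              mul_inv_cancel₀ hmpos.ne', one_mul]
            exact_mod_cast (by
              rw [inv_mul_le_iff₀ (by positivity)]; simp : (1 + M)⁻¹ * M ≤ 1)
    have hint := Φ.integrable_mul hu (memSpace_of_modular_le_one hv1)
    have hz : ∫ t, u t * v t ∂μ = 0 := by
      have := Φ.le_orliczNorm hu hv1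
      rw [h0] at this
      exact abs_nonpos_iff.1 this
    have hprod : ∀ᵐ t ∂μ, u t * v t = (A n).indicator (fun t => (c : ℝ) * |u t|) t := by
      filter_upwards [hve] with t h2
      rw [h2]
      by_cases ht : t ∈ A n
      · simp only [hv₀, Set.indicator_of_mem ht]
        split_ifs with hp
        · rw [abs_of_nonneg hp, mul_comm]
        · rw [abs_of_neg (not_le.1 hp)]; ring
      · simp [hv₀, Set.indicator_of_notMem ht]
    have hnn : 0 ≤ᵐ[μ] fun t => u t * v t := by
      filter_upwards [hprod] with t h
      rw [h]
      exact Set.indicator_nonneg (fun _ _ => by positivity) t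
    have hae := (integral_eq_zero_iff_of_nonneg_ae hnn hint).1 hz
    filter_upwards [hae, hprod] with t h1 h2 ht
    rw [h2, Set.indicator_of_mem ht] at h1
    have hc0 : (c : ℝ) ≠ 0 := by exact_mod_cast hcpos.ne'
    simpa [hc0] using h1
  have hmk : ∀ᵐ t ∂μ, ∀ n, Φ.toFun t ((n + 1 : ℕ) : ℝ≥0∞) = (hmeas n).mk _ t :=
    ae_all_iff.2 fun n => (hmeas n).ae_eq_mk
  refine AEEqFun.ext ?_
  filter_upwards [ae_all_iff.2 hkey, hmk, Φ.monotone, Φ.lowerSemicontinuous, Φ.map_top,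
    AEEqFun.coeFn_zero (α := T) (μ := μ) (β := ℝ)] with t h1 h2 hm hl ht hz
  rw [hz]
  have hev : ∀ᶠ x in 𝓝 ∞, 1 < Φ.toFun t x := hl ∞ 1 (lt_of_lt_of_eq ENNReal.one_lt_top ht.symm)
  have hev2 := (ENNReal.tendsto_nat_nhds_top.eventually hev).and
    (eventually_ge_atTop (spanningSetsIndex μ t))
  obtain ⟨n, hn1, hn2⟩ := hev2.exists
  refine h1 n ⟨mem_spanningSets_of_index_le μ t hn2, ?_⟩
  simp only [Set.mem_ofPred_eq, ← h2]
  exact hn1.le.trans (hm (by exact_mod_cast Nat.le_succ n))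

end MusielakOrliczFunction

/-- The space `L₀^Φ`: the Musielak--Orlicz space `L^Φ` equipped with the Orlicz norm. -/
def OrliczSpace (Φ : MusielakOrliczFunction μ) : Type _ := Φ.space

namespace OrliczSpace

variable (Φ : MusielakOrliczFunction μ)

/-- The measurable function (up to equality almost everywhere) underlying an element of `L₀^Φ`. -/
def toAEEqFun {Φ : MusielakOrliczFunction μ} (u : OrliczSpace Φ) : T →ₘ[μ] ℝ := Subtype.val u

theorem memSpace {Φ : MusielakOrliczFunction μ} (u : OrliczSpace Φ) :
    MemSpace μ Φ.toFun u.toAEEqFun := Subtype.property u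

instance instAddCommGroup : AddCommGroup (OrliczSpace Φ) :=
  inferInstanceAs (AddCommGroup Φ.space)

instance instModule : Module ℝ (OrliczSpace Φ) := inferInstanceAs (Module ℝ Φ.space)

noncomputable instance instNormedAddCommGroup [SigmaFinite μ] :
    NormedAddCommGroup (OrliczSpace Φ) :=
  AddGroupNorm.toNormedAddCommGroup
    { toFun := fun u => Φ.orliczNorm u.toAEEqFun
      map_zero' := Φ.orliczNorm_zero
      add_le' := fun u w => Φ.orliczNorm_add_le u.memSpace w.memSpace
      neg' := fun u => by
        have h := Φ.orliczNorm_smul (-1) u.toAEEqFun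
        rw [neg_one_smul, abs_neg, abs_one, one_mul] at h
        exact h
      eq_zero_of_map_eq_zero' := fun u hu =>
        Subtype.ext (Φ.eq_zero_of_orliczNorm_eq_zero u.memSpace hu) }

theorem norm_def [SigmaFinite μ] (u : OrliczSpace Φ) : ‖u‖ = Φ.orliczNorm u.toAEEqFun := rfl

noncomputable instance instNormedSpace [SigmaFinite μ] : NormedSpace ℝ (OrliczSpace Φ) where
  norm_smul_le c u := (Φ.orliczNorm_smul c u.toAEEqFun).le

/-- The order continuous functional `f_v(u) = ∫ u v dμ` on `L₀^Φ`, for `v ∈ L^{Φ*}`. -/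
noncomputable def integralFunctional [SigmaFinite μ] (v : T →ₘ[μ] ℝ)
    (hv : MemSpace μ (conj Φ.toFun) v) : StrongDual ℝ (OrliczSpace Φ) :=
  LinearMap.mkContinuousOfExistsBound
    { toFun := fun u => ∫ t, u.toAEEqFun t * v t ∂μ
      map_add' := fun u w => by
        rw [← integral_add (Φ.integrable_mul u.memSpace hv) (Φ.integrable_mul w.memSpace hv)]
        refine integral_congr_ae ?_
        filter_upwards [AEEqFun.coeFn_add u.toAEEqFun w.toAEEqFun] with t e
        have e' : (u + w).toAEEqFun t = (u.toAEEqFun + w.toAEEqFun) t := rfl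
        simp only [e', e, Pi.add_apply, add_mul]
      map_smul' := fun c u =>
        MusielakOrliczFunction.integral_smul_mul c u.toAEEqFun v }
    (by
      obtain ⟨b, hb, hv⟩ := hv
      -- shrink the factor until the modular is at most one
      set I := modular μ (conj Φ.toFun) (b • v) with hI
      set c : ℝ := (1 + I.toReal)⁻¹ with hc
      have hc0 : 0 < c := by positivity
      have hc1 : c ≤ 1 := inv_le_one_of_one_le₀ (by simp)
      have hmod : modular μ (conj Φ.toFun) ((c * b) • v) ≤ 1 := by
        calc modular μ (conj Φ.toFun) ((c * b) • v)
            ≤ ∫⁻ t, ENNReal.ofReal c * conj Φ.toFun t (ENNReal.ofReal |(b • v) t|) ∂μ := by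
              refine lintegral_mono_ae ?_
              filter_upwards [AEEqFun.coeFn_smul (c * b) v, AEEqFun.coeFn_smul b v] with t e1 e2
              rw [e1, e2]
              simp only [Pi.smul_apply, smul_eq_mul]
              rw [mul_assoc, abs_mul c, abs_of_pos hc0, ENNReal.ofReal_mul hc0.le]
              refine iSup_le fun x => iSup_le fun hx0 => iSup_le fun hx => ?_
              calc x * (ENNReal.ofReal c * ENNReal.ofReal |b * v t|) - Φ.toFun t x
                  ≤ ENNReal.ofReal c * (x * ENNReal.ofReal |b * v t|)
                    - ENNReal.ofReal c * Φ.toFun t x := by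
                    rw [mul_left_comm]
                    refine tsub_le_tsub_left ?_ _
                    exact mul_le_of_le_one_left zero_le (by simpa using hc1)
                _ = ENNReal.ofReal c * (x * ENNReal.ofReal |b * v t| - Φ.toFun t x) := by
                    rw [ENNReal.mul_sub (fun _ _ => ENNReal.ofReal_ne_top)]
                _ ≤ _ := by
                    gcongr
                    exact le_iSup_of_le x (le_iSup_of_le hx0 (le_iSup_of_le hx le_rfl))
          _ = ENNReal.ofReal c * I := by
              rw [lintegral_const_mul' _ _ ENNReal.ofReal_ne_top]; rfl
          _ ≤ 1 := by
              rw [← ENNReal.ofReal_toReal hv.ne, ← ENNReal.ofReal_mul hc0.le,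
                ENNReal.ofReal_le_one, hc, inv_mul_le_iff₀ (by positivity)]
              simp
      refine ⟨(c * b)⁻¹, fun u => ?_⟩
      have h := Φ.le_orliczNorm u.memSpace hmod
      have e : ∫ t, u.toAEEqFun t * ((c * b) • v) t ∂μ =
          (c * b) * ∫ t, u.toAEEqFun t * v t ∂μ := by
        simp_rw [mul_comm (u.toAEEqFun _)]
        exact MusielakOrliczFunction.integral_smul_mul _ _ _
      rw [e, abs_mul, abs_of_pos (show 0 < c * b by positivity)] at h
      rw [norm_def, inv_mul_eq_div, le_div_iff₀' (by positivity)]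
      exact h)

theorem integralFunctional_apply [SigmaFinite μ] (v : T →ₘ[μ] ℝ)
    (hv : MemSpace μ (conj Φ.toFun) v) (u : OrliczSpace Φ) :
    integralFunctional Φ v hv u = ∫ t, u.toAEEqFun t * v t ∂μ := rfl

variable {Φ}

/-- The modulus `|f|` of a functional in the dual Banach lattice, evaluated at a non-negative `u`:
`|f|(u) = sup {|f(w)| : |w| ≤ u}`. -/
noncomputable def absFunctional [SigmaFinite μ] (f : StrongDual ℝ (OrliczSpace Φ))
    (u : OrliczSpace Φ) : ℝ≥0∞ :=
  ⨆ (w : OrliczSpace Φ) (_ : ∀ᵐ t ∂μ, |w.toAEEqFun t| ≤ u.toAEEqFun t), ENNReal.ofReal |f w|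

/-- `0 ≤ uₙ ↑ u`, almost everywhere. -/
def IncreasesTo (un : ℕ → OrliczSpace Φ) (u : OrliczSpace Φ) : Prop :=
  ∀ᵐ t ∂μ, (∀ n, 0 ≤ (un n).toAEEqFun t) ∧ Monotone (fun n => (un n).toAEEqFun t) ∧
    Tendsto (fun n => (un n).toAEEqFun t) atTop (𝓝 (u.toAEEqFun t))

/-- The order continuous component of the positive functional `|f|`, evaluated at a non-negative
`u`: `|f|_c(u) = inf {sup_n |f|(uₙ) : 0 ≤ uₙ ↑ u}`. -/
noncomputable def absOrderContinuousPart [SigmaFinite μ] (f : StrongDual ℝ (OrliczSpace Φ))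
    (u : OrliczSpace Φ) : ℝ≥0∞ :=
  ⨅ (un : ℕ → OrliczSpace Φ) (_ : IncreasesTo un u), ⨆ n, absFunctional f (un n)

/-- A functional `f` is purely singular if its order continuous component `f_c` vanishes, that is,
if `|f|_c = |f_c|` vanishes on the non-negative elements of `L₀^Φ`. -/
def IsPurelySingular [SigmaFinite μ] (f : StrongDual ℝ (OrliczSpace Φ)) : Prop :=
  ∀ u : OrliczSpace Φ, (∀ᵐ t ∂μ, 0 ≤ u.toAEEqFun t) → absOrderContinuousPart f u = 0

end OrliczSpace

end MusielakOrlicz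

/-! ### Scaling and gluing for the complementary modular -/

namespace MusielakOrlicz

variable {T : Type*}

/-! By homogeneity it suffices to show that `‖f_v + s‖ ≤ 1` if and only if `I_{Φ*}(v) + ‖s‖ ≤ 1`.
Pure singularity enters only through `IsTailFunctional`: below a fixed `u`, the functional `s` is
carried, up to `ε`, by a set `E` on which any prescribed integrable density has integral at most
`ε`. So `s` acts on `E` and `f_v` off `E`, and the two can be tested independently by gluing
functions along `E`.

If `I_{Φ*}(v) + ‖s‖ ≤ 1` (`norm_le_one_of_conj_modular_add_le`), pick `w'` nearly attaining the
Orlicz norm of `u 1_E`. The function equal to `‖s‖ w'` on `E` and to `v` off `E` has modular at most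
`‖s‖ + I_{Φ*}(v) ≤ 1`, and its pairing with `u` is, up to errors, at least `f_v(u) + s(u)`; hence
`f_v(u) + s(u) ≤ ‖u‖`.

Conversely (`integral_add_apply_le`), for `I_Φ(u) < ∞` and `‖z‖ ≤ 1` the function `x` equal to `z`
on `E` and to `u` off `E` has norm at most about `1 + I_Φ(u)`, while `f(x)` is about `f_v(u) +
s(z)`. The supremum over `z` gives `∫ u v - I_Φ(u) ≤ 1 - ‖s‖`, and the supremum over `u` turns the
left side into `I_{Φ*}(v)` by the integral conjugacy `modular_conj_le`. -/

/-- The complementary function is contracted by factors at most one. -/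
theorem conj_smul_le (Φ : T → ℝ≥0∞ → ℝ≥0∞) (t : T) {c : ℝ≥0∞} (hc : c ≤ 1) (x : ℝ≥0∞) :
    conj Φ t (c * x) ≤ c * conj Φ t x := by
  refine iSup_le fun y => iSup_le fun hy0 => iSup_le fun hy => ?_
  have hct : c ≠ ∞ := ne_top_of_le_ne_top ENNReal.one_ne_top hc
  calc y * (c * x) - Φ t y ≤ c * (y * x) - c * Φ t y := by
        rw [mul_left_comm]
        -- Only `c Φ ≤ Φ` is needed here, so no convexity of `Φ` enters.
        exact tsub_le_tsub_left (mul_le_of_le_one_left zero_le hc) _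
    _ = c * (y * x - Φ t y) := by rw [ENNReal.mul_sub (fun _ _ => hct)]
    _ ≤ _ := by
        gcongr
        exact le_iSup_of_le y (le_iSup_of_le hy0 (le_iSup_of_le hy le_rfl))

variable [MeasurableSpace T] {μ : Measure T}

theorem modular_congr {Ψ : T → ℝ≥0∞ → ℝ≥0∞} {v w : T →ₘ[μ] ℝ} (h : ∀ᵐ t ∂μ, |v t| = |w t|) :
    modular μ Ψ v = modular μ Ψ w := by
  refine lintegral_congr_ae ?_
  filter_upwards [h] with t h
  rw [h]

theorem modular_conj_smul_le (Φ : T → ℝ≥0∞ → ℝ≥0∞) {c : ℝ} (h0 : |c| ≤ 1) (v : T →ₘ[μ] ℝ) :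
    modular μ (conj Φ) (c • v) ≤ ENNReal.ofReal |c| * modular μ (conj Φ) v := by
  unfold modular
  rw [← lintegral_const_mul' _ _ ENNReal.ofReal_ne_top]
  refine lintegral_mono_ae ?_
  filter_upwards [AEEqFun.coeFn_smul c v] with t e
  rw [e, Pi.smul_apply, smul_eq_mul, abs_mul, ENNReal.ofReal_mul (abs_nonneg c)]
  exact conj_smul_le Φ t (by simpa using h0) _

theorem modular_conj_neg (Φ : T → ℝ≥0∞ → ℝ≥0∞) (v : T →ₘ[μ] ℝ) :
    modular μ (conj Φ) (-v) = modular μ (conj Φ) v := by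
  refine modular_congr ?_
  filter_upwards [AEEqFun.coeFn_neg v] with t e
  simp [e]

theorem modular_conj_zero (Φ : T → ℝ≥0∞ → ℝ≥0∞) :
    modular μ (conj Φ) (0 : T →ₘ[μ] ℝ) = 0 := by
  have h := modular_conj_smul_le (μ := μ) Φ (c := 0) (by simp) 0
  simpa using h

open Classical in
/-- The function equal to `a` on `E` and to `b` on the complement of `E`. -/
noncomputable def glue (E : Set T) (hE : MeasurableSet E) (a b : T →ₘ[μ] ℝ) : T →ₘ[μ] ℝ :=
  AEEqFun.mk (E.piecewise a b)
    (a.stronglyMeasurable.piecewise hE b.stronglyMeasurable).aestronglyMeasurable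

section Glue

variable {E : Set T} (hE : MeasurableSet E) (a b c : T →ₘ[μ] ℝ)

theorem glue_of_mem : ∀ᵐ t ∂μ, t ∈ E → glue E hE a b t = a t := by
  classical
  filter_upwards [AEEqFun.coeFn_mk (E.piecewise a b)
    (a.stronglyMeasurable.piecewise hE b.stronglyMeasurable).aestronglyMeasurable] with t h ht
  rw [glue]
  convert h using 1
  simp [ht]

theorem glue_of_notMem : ∀ᵐ t ∂μ, t ∉ E → glue E hE a b t = b t := by
  classical
  filter_upwards [AEEqFun.coeFn_mk (E.piecewise a b)
    (a.stronglyMeasurable.piecewise hE b.stronglyMeasurable).aestronglyMeasurable] with t h ht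
  rw [glue]
  convert h using 1
  simp [ht]

theorem modular_glue (Ψ : T → ℝ≥0∞ → ℝ≥0∞) :
    modular μ Ψ (glue E hE a b) = ∫⁻ t in E, Ψ t (ENNReal.ofReal |a t|) ∂μ +
      ∫⁻ t in Eᶜ, Ψ t (ENNReal.ofReal |b t|) ∂μ := by
  unfold modular
  rw [← lintegral_add_compl _ hE]
  congr 1
  · refine setLIntegral_congr_fun_ae hE ?_
    filter_upwards [glue_of_mem hE a b] with t h ht
    rw [h ht]
  · refine setLIntegral_congr_fun_ae hE.compl ?_
    filter_upwards [glue_of_notMem hE a b] with t h ht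
    rw [h ht]

theorem integral_glue (ha : Integrable (fun t => c t * a t) μ)
    (hb : Integrable (fun t => c t * b t) μ) :
    ∫ t, c t * glue E hE a b t ∂μ =
      ∫ t in E, c t * a t ∂μ + ∫ t in Eᶜ, c t * b t ∂μ := by
  classical
  have e : (fun t => c t * glue E hE a b t) =ᵐ[μ]
      E.piecewise (fun t => c t * a t) (fun t => c t * b t) := by
    filter_upwards [glue_of_mem hE a b, glue_of_notMem hE a b] with t h1 h2
    by_cases ht : t ∈ E
    · simp [ht, h1 ht]
    · simp [ht, h2 ht]
  rw [integral_congr_ae e, integral_piecewise hE ha.integrableOn hb.integrableOn]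

end Glue

namespace MusielakOrliczFunction

theorem memSpace_of_le (Φ : MusielakOrliczFunction μ) {u w : T →ₘ[μ] ℝ}
    (hu : MemSpace μ Φ.toFun u) (h : ∀ᵐ t ∂μ, |w t| ≤ |u t|) : MemSpace μ Φ.toFun w := by
  obtain ⟨a, ha, hu⟩ := hu
  refine ⟨a, ha, lt_of_le_of_lt (Φ.modular_le ?_) hu⟩
  filter_upwards [h, AEEqFun.coeFn_smul a u, AEEqFun.coeFn_smul a w] with t h e1 e2
  rw [e1, e2, Pi.smul_apply, Pi.smul_apply, smul_eq_mul, smul_eq_mul, abs_mul, abs_mul]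
  gcongr

end MusielakOrliczFunction

/-! ### Restrictions, and functionals carried by small sets -/

namespace OrliczSpace

variable {Φ : MusielakOrliczFunction μ}

/-- The restriction of an element of `L₀^Φ` to a measurable set. -/
noncomputable def restrict (E : Set T) (hE : MeasurableSet E) (u : OrliczSpace Φ) :
    OrliczSpace Φ :=
  ⟨glue E hE u.toAEEqFun 0, Φ.memSpace_of_le u.memSpace (by
    filter_upwards [glue_of_mem hE u.toAEEqFun 0, glue_of_notMem hE u.toAEEqFun 0,
      AEEqFun.coeFn_zero (α := T) (μ := μ) (β := ℝ)] with t h1 h2 h3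
    by_cases ht : t ∈ E
    · rw [h1 ht]
    · rw [h2 ht, h3]; simp)⟩

theorem restrict_ae (E : Set T) (hE : MeasurableSet E) (u : OrliczSpace Φ) :
    ∀ᵐ t ∂μ, (restrict E hE u).toAEEqFun t = E.indicator u.toAEEqFun t := by
  filter_upwards [glue_of_mem hE u.toAEEqFun 0, glue_of_notMem hE u.toAEEqFun 0,
    AEEqFun.coeFn_zero (α := T) (μ := μ) (β := ℝ)] with t h1 h2 h3
  by_cases ht : t ∈ E
  · rw [Set.indicator_of_mem ht]; exact h1 ht
  · rw [Set.indicator_of_notMem ht]; exact (h2 ht).trans h3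

theorem restrict_add_restrict_compl (E : Set T) (hE : MeasurableSet E) (u : OrliczSpace Φ) :
    restrict E hE u + restrict Eᶜ hE.compl u = u := by
  refine Subtype.ext (AEEqFun.ext ?_)
  filter_upwards [AEEqFun.coeFn_add (restrict E hE u).toAEEqFun (restrict Eᶜ hE.compl u).toAEEqFun,
    restrict_ae E hE u, restrict_ae Eᶜ hE.compl u] with t e h1 h2
  refine e.trans ?_
  rw [Pi.add_apply, h1, h2]
  exact congrFun (Set.indicator_self_add_compl E u.toAEEqFun) t

theorem integral_restrict (E : Set T) (hE : MeasurableSet E) (u : OrliczSpace Φ)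
    (w : T →ₘ[μ] ℝ) :
    ∫ t, (restrict E hE u).toAEEqFun t * w t ∂μ = ∫ t in E, u.toAEEqFun t * w t ∂μ := by
  rw [← integral_indicator hE]
  refine integral_congr_ae ?_
  filter_upwards [restrict_ae E hE u] with t h
  rw [h]
  by_cases ht : t ∈ E <;> simp [ht]

theorem toAEEqFun_smul_ae (c : ℝ) (u : OrliczSpace Φ) :
    ∀ᵐ t ∂μ, (c • u).toAEEqFun t = c * u.toAEEqFun t :=
  AEEqFun.coeFn_smul c u.toAEEqFun

theorem toAEEqFun_add_ae (u w : OrliczSpace Φ) :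
    ∀ᵐ t ∂μ, (u + w).toAEEqFun t = u.toAEEqFun t + w.toAEEqFun t :=
  AEEqFun.coeFn_add u.toAEEqFun w.toAEEqFun

variable [SigmaFinite μ]

/-- A functional is asymptotically supported on small sets if it is arbitrarily small on the
functions that are dominated by a given one and vanish on a suitable set which is small with
respect to a given finite density. -/
def IsTailFunctional (s : StrongDual ℝ (OrliczSpace Φ)) : Prop :=
  ∀ (u : OrliczSpace Φ) (g : T → ℝ≥0∞) (ε : ℝ), (∀ᵐ t ∂μ, 0 ≤ u.toAEEqFun t) →
    AEMeasurable g μ → ∫⁻ t, g t ∂μ ≠ ∞ → 0 < ε →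
    ∃ E : Set T, MeasurableSet E ∧ ∫⁻ t in E, g t ∂μ ≤ ENNReal.ofReal ε ∧
      ∀ w : OrliczSpace Φ, (∀ᵐ t ∂μ, |w.toAEEqFun t| ≤ u.toAEEqFun t) →
        (∀ᵐ t ∂μ, t ∈ E → w.toAEEqFun t = 0) → |s w| ≤ ε

theorem IsTailFunctional.smul {s : StrongDual ℝ (OrliczSpace Φ)} (hs : IsTailFunctional s)
    (c : ℝ) : IsTailFunctional (c • s) := by
  intro u g ε hu hg hgi hε
  have hpos : 0 < 1 + |c| := by positivity
  -- Dividing by `1 + |c|` rather than `|c|` covers `c = 0` and also keeps the tolerance below `ε`.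
  obtain ⟨E, hE, hgE, h⟩ := hs u g (ε / (1 + |c|)) hu hg hgi (by positivity)
  refine ⟨E, hE, hgE.trans (ENNReal.ofReal_le_ofReal ?_), fun w hw hwE => ?_⟩
  · exact div_le_self hε.le (by simp)
  · have := h w hw hwE
    rw [le_div_iff₀ hpos] at this
    change |c * s w| ≤ ε
    rw [abs_mul]
    nlinarith [abs_nonneg (s w)]

/-- Singularity gives `0 ≤ uₙ ↑ u` with `|s|(uₙ) < ε/2` for all `n`. The sets where `uₙ` is still
below `u/2` shrink to a null set, and off such a set a function dominated by `u` is, after halving,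
dominated by `uₙ`. -/
theorem IsPurelySingular.isTailFunctional {s : StrongDual ℝ (OrliczSpace Φ)}
    (hs : IsPurelySingular s) : IsTailFunctional s := by
  intro u g ε hu hg hgi hε
  have h0 := hs u hu
  have hlt : absOrderContinuousPart s u < ENNReal.ofReal (ε / 2) := by
    rw [h0]; simpa using hε
  simp only [absOrderContinuousPart, iInf_lt_iff] at hlt
  obtain ⟨un, hinc, hsup⟩ := hlt
  -- The factor `1/2` leaves room: where `u > 0` the sequence eventually exceeds `u/2`, though it
  -- need never reach `u`. Points with `u = 0` are never in `F n`, because `uₙ ≥ 0`.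
  set F : ℕ → Set T := fun n => {t | (un n).toAEEqFun t < u.toAEEqFun t / 2} with hF
  have hFm : ∀ n, MeasurableSet (F n) := fun n =>
    measurableSet_lt (un n).toAEEqFun.stronglyMeasurable.measurable
      (u.toAEEqFun.stronglyMeasurable.measurable.div_const 2)
  have htend : Tendsto (fun n => ∫⁻ t in F n, g t ∂μ) atTop (𝓝 (∫⁻ _, 0 ∂μ)) := by
    have e : ∀ n, ∫⁻ t in F n, g t ∂μ = ∫⁻ t, (F n).indicator g t ∂μ := fun n =>
      (lintegral_indicator (hFm n) g).symm
    simp_rw [e]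
    refine tendsto_lintegral_of_dominated_convergence' g (fun n => hg.indicator (hFm n))
      (fun n => ae_of_all _ fun t => Set.indicator_le_self _ _ _) hgi ?_
    filter_upwards [hinc] with t ⟨h1, _, h3⟩
    refine tendsto_const_nhds.congr' ?_
    rcases eq_or_ne (u.toAEEqFun t) 0 with hz | hz
    · refine Eventually.of_forall fun n => ?_
      refine (Set.indicator_of_notMem ?_ _).symm
      simp only [hF, Set.mem_ofPred_eq, hz, zero_div, not_lt]
      exact h1 n
    · have hu0 : 0 < u.toAEEqFun t := lt_of_le_of_ne (ge_of_tendsto' h3 h1) hz.symm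
      filter_upwards [h3.eventually (lt_mem_nhds (half_lt_self hu0))] with n hn
      refine (Set.indicator_of_notMem ?_ _).symm
      simp only [hF, Set.mem_ofPred_eq, not_lt]
      exact hn.le
  rw [lintegral_zero] at htend
  obtain ⟨n, hn⟩ := (htend.eventually
    (gt_mem_nhds (show 0 < ENNReal.ofReal ε by simpa using hε))).exists
  refine ⟨F n, hFm n, hn.le, fun w hw hwF => ?_⟩
  -- Here `|w|/2 ≤ uₙ`: on `F n` because `w` vanishes, off it because `|w|/2 ≤ u/2 ≤ uₙ`. So `w/2`
  -- competes in the supremum defining `|s|(uₙ)`.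
  have h2 : ENNReal.ofReal |s ((1 / 2 : ℝ) • w)| ≤ ENNReal.ofReal (ε / 2) := by
    refine le_trans ?_ ((le_iSup _ n).trans hsup.le)
    refine le_iSup₂_of_le ((1 / 2 : ℝ) • w) ?_ le_rfl
    filter_upwards [toAEEqFun_smul_ae (1 / 2) w, hw, hwF, hinc] with t e h1 h2 ⟨h3, _⟩
    rw [e]
    by_cases ht : t ∈ F n
    · rw [h2 ht]; simpa using h3 n
    · simp only [hF, Set.mem_ofPred_eq, not_lt] at ht
      rw [abs_mul, abs_of_pos (by norm_num : (0 : ℝ) < 1 / 2)]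
      linarith
  rw [ENNReal.ofReal_le_ofReal_iff (by positivity), map_smul, smul_eq_mul, abs_mul,
    abs_of_pos (by norm_num : (0 : ℝ) < 1 / 2)] at h2
  linarith

end OrliczSpace

/-! ### Conjugacy of the two modulars -/

namespace MusielakOrliczFunction

/-- The supremum defining the complementary function may be taken over a dense sequence. -/
theorem conj_le_iSup (Φ : MusielakOrliczFunction μ) {q : ℕ → ℝ≥0} (hq : DenseRange q) :
    ∀ᵐ t ∂μ, ∀ x : ℝ≥0, conj Φ.toFun t x ≤ ⨆ k, ((q k : ℝ≥0∞) * x - Φ.toFun t (q k)) := by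
  filter_upwards [Φ.monotone] with t hm x
  refine iSup_le fun y => iSup_le fun hy0 => iSup_le fun hy => ?_
  lift y to ℝ≥0 using hy.ne
  have hy0 : 0 < y := by exact_mod_cast hy0
  -- Monotonicity replaces continuity of `Φ t`: a point `q k` in `(z, y)` costs at most `Φ t y` and
  -- gains at least `z x`. Only the linear term is then passed to the limit `z ↑ y`.
  have key : ∀ z : ℝ≥0, z < y → (z : ℝ≥0∞) * x - Φ.toFun t y ≤
      ⨆ k, ((q k : ℝ≥0∞) * x - Φ.toFun t (q k)) := by
    intro z hz
    obtain ⟨k, hk⟩ := hq.exists_mem_open isOpen_Ioo (Set.nonempty_Ioo.2 hz)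
    refine le_iSup_of_le k (tsub_le_tsub ?_ (hm (by exact_mod_cast hk.2.le)))
    gcongr
    exact hk.1.le
  have hne : (𝓝[<] y).NeBot := nhdsLT_neBot_of_exists_lt ⟨0, hy0⟩
  have hcont : Tendsto (fun z : ℝ≥0 => (z : ℝ≥0∞) * x - Φ.toFun t y) (𝓝[<] y)
      (𝓝 ((y : ℝ≥0∞) * x - Φ.toFun t y)) := by
    have h1 : Tendsto (fun z : ℝ≥0 => ((z * x : ℝ≥0) : ℝ≥0∞)) (𝓝[<] y) (𝓝 ((y * x : ℝ≥0) : ℝ≥0∞)) :=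
      ENNReal.tendsto_coe.2 ((tendsto_id.mul_const x).mono_left nhdsWithin_le_nhds)
    simp only [ENNReal.coe_mul] at h1
    exact ENNReal.Tendsto.sub h1 tendsto_const_nhds
      (Or.inl (ENNReal.mul_ne_top ENNReal.coe_ne_top ENNReal.coe_ne_top))
  exact le_of_tendsto hcont (eventually_nhdsWithin_of_forall key)

/-- Measurable selection of a near maximizer of `x V(t) - Φ(t, x)`. -/
theorem exists_selection (Φ : MusielakOrliczFunction μ) (q : ℕ → ℝ≥0) {V : T → ℝ≥0}
    (hV : Measurable V) (N : ℕ) :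
    ∃ h : T → ℝ≥0, Measurable h ∧ (∃ C : ℝ≥0, ∀ t, h t ≤ C) ∧
      (∀ᵐ t ∂μ, Φ.toFun t (h t) ≤ h t * V t) ∧
      ∀ᵐ t ∂μ, ∀ k < N,
        (q k : ℝ≥0∞) * V t - Φ.toFun t (q k) ≤ h t * V t - Φ.toFun t (h t) := by
  classical
  induction N with
  | zero =>
    -- The selection starts from `0`, where `Φ` vanishes, and moves to `q N` only where this
    -- strictly increases the truncated difference. That difference is then positive, so `Φ t (h t)
    -- ≤ h t * V t` persists.
    refine ⟨0, measurable_zero, ⟨0, fun t => le_rfl⟩, ?_, by simp⟩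
    filter_upwards [Φ.map_zero] with t h
    simp [h]
  | succ N ih =>
    obtain ⟨h, hm, ⟨C, hC⟩, h1, h2⟩ := ih
    have hnull : NullMeasurableSet {t | (h t : ℝ≥0∞) * V t - Φ.toFun t (h t) <
        (q N : ℝ≥0∞) * V t - Φ.toFun t (q N)} μ :=
      nullMeasurableSet_lt
        ((hm.coe_nnreal_ennreal.mul hV.coe_nnreal_ennreal).aemeasurable.sub
          (Φ.aemeasurable_comp hm.coe_nnreal_ennreal.aemeasurable))
        ((hV.coe_nnreal_ennreal.const_mul _).aemeasurable.sub (Φ.aemeasurable _))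
    -- The comparison set is only null-measurable; an almost everywhere equal measurable set keeps
    -- `h` measurable.
    obtain ⟨A, -, hA, hAe⟩ := hnull.exists_measurable_superset_ae_eq
    refine ⟨A.piecewise (fun _ => q N) h, measurable_const.piecewise hA hm,
      ⟨max (q N) C, fun t => ?_⟩, ?_, ?_⟩
    · by_cases ht : t ∈ A
      · simp [ht]
      · simp [ht, hC t]
    · filter_upwards [h1, hAe.mem_iff] with t h1 hiff
      by_cases ht : t ∈ A
      · have := hiff.1 ht
        simp only [Set.piecewise_eq_of_mem _ _ _ ht]
        exact (tsub_pos_iff_lt.1 (lt_of_le_of_lt zero_le this)).le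
      · simpa only [Set.piecewise_eq_of_notMem _ _ _ ht] using h1
    · filter_upwards [h2, hAe.mem_iff] with t h2 hiff k hk
      by_cases ht : t ∈ A
      · have := hiff.1 ht
        simp only [Set.piecewise_eq_of_mem _ _ _ ht]
        rcases Nat.lt_succ_iff_lt_or_eq.1 hk with hk | rfl
        · exact (h2 k hk).trans this.le
        · exact le_rfl
      · have := mt hiff.2 ht
        rw [not_lt] at this
        simp only [Set.piecewise_eq_of_notMem _ _ _ ht]
        rcases Nat.lt_succ_iff_lt_or_eq.1 hk with hk | rfl
        · exact h2 k hk
        · exact this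

/-- The complementary modular is the convex conjugate of the modular: a bound for
`∫ u v dμ - I_Φ(u)` on the domain of `I_Φ` bounds `I_{Φ*}(v)`. -/
theorem modular_conj_le [SigmaFinite μ] (Φ : MusielakOrliczFunction μ) {v : T →ₘ[μ] ℝ}
    (hv : MemSpace μ (conj Φ.toFun) v) {M : ℝ}
    (hM : ∀ u : T →ₘ[μ] ℝ, modular μ Φ.toFun u < ∞ →
      ∫ t, u t * v t ∂μ ≤ M + (modular μ Φ.toFun u).toReal) :
    modular μ (conj Φ.toFun) v ≤ ENNReal.ofReal M := by
  have hM0 : 0 ≤ M := by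
    have h := hM 0 (by simp [Φ.modular_zero])
    rw [integral_congr_ae (g := fun _ => 0)] at h
    · simpa [Φ.modular_zero] using h
    · filter_upwards [AEEqFun.coeFn_zero (α := T) (μ := μ) (β := ℝ)] with t h
      simp [h]
  have hvm : Measurable v := v.stronglyMeasurable.measurable
  set V : T → ℝ≥0 := fun t => Real.toNNReal |v t| with hVdef
  have hV : Measurable V := (continuous_abs.measurable.comp hvm).real_toNNReal
  set q := TopologicalSpace.denseSeq ℝ≥0
  choose h hm hC h1 h2 using fun N => Φ.exists_selection q hV N
  -- On `B N` the measure is finite and `V` is bounded. As `h N` is bounded too, the test functions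
  -- built below have finite modular, so `hM` applies to them.
  set B : ℕ → Set T := fun N => spanningSets μ N ∩ {t | V t ≤ N} with hB
  have hBm : ∀ N, MeasurableSet (B N) := fun N =>
    (measurableSet_spanningSets μ N).inter (measurableSet_le hV measurable_const)
  set G : ℕ → T → ℝ≥0∞ := fun N => (B N).indicator
    fun t => (h N t : ℝ≥0∞) * V t - Φ.toFun t (h N t) with hG
  have hΦm : ∀ N, AEMeasurable (fun t => Φ.toFun t (h N t)) μ := fun N =>
    Φ.aemeasurable_comp (hm N).coe_nnreal_ennreal.aemeasurable
  have hGm : ∀ N, AEMeasurable (G N) μ := fun N =>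
    (((hm N).coe_nnreal_ennreal.mul hV.coe_nnreal_ennreal).aemeasurable.sub
      (hΦm N)).indicator (hBm N)
  have hGle : ∀ N, ∫⁻ t, G N t ∂μ ≤ ENNReal.ofReal M := by
    intro N
    obtain ⟨C, hC⟩ := hC N
    -- The sign of `v` makes the test function satisfy `u v = h |v|` on `B N`.
    have hum : Measurable ((B N).indicator fun t => (h N t : ℝ) * SignType.sign (v t)) := by
      refine Measurable.indicator ?_ (hBm N)
      refine (hm N).coe_nnreal_real.mul ?_
      have : Measurable fun x : ℝ => ((SignType.sign x : SignType) : ℝ) := by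
        have e : (fun x : ℝ => ((SignType.sign x : SignType) : ℝ)) =
            fun x => if 0 < x then 1 else if x < 0 then -1 else 0 := by
          ext x
          rw [sign_apply]
          split_ifs <;> simp
        rw [e]
        exact Measurable.ite measurableSet_Ioi measurable_const
          (Measurable.ite measurableSet_Iio measurable_const measurable_const)
      exact this.comp hvm
    set u : T →ₘ[μ] ℝ := AEEqFun.mk _ hum.aestronglyMeasurable with hu
    have hue : ∀ᵐ t ∂μ, u t = (B N).indicator (fun t => (h N t : ℝ) * SignType.sign (v t)) t :=
      AEEqFun.coeFn_mk _ _
    have hprod : ∀ᵐ t ∂μ, u t * v t = (B N).indicator (fun t => (h N t : ℝ) * V t) t := by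
      filter_upwards [hue] with t e
      rw [e]
      by_cases ht : t ∈ B N
      · simp only [Set.indicator_of_mem ht, hVdef, Real.coe_toNNReal _ (abs_nonneg _)]
        rw [mul_assoc, sign_mul_self]
      · simp [ht]
    have hmod : modular μ Φ.toFun u ≤ ∫⁻ t in B N, Φ.toFun t (h N t) ∂μ := by
      rw [← lintegral_indicator (hBm N)]
      refine lintegral_mono_ae ?_
      filter_upwards [hue, Φ.monotone, Φ.map_zero] with t e hmon h0
      rw [e]
      by_cases ht : t ∈ B N
      · simp only [Set.indicator_of_mem ht]
        refine hmon ?_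
        rw [abs_mul, NNReal.abs_eq, ENNReal.ofReal_mul NNReal.zero_le_coe,
          ENNReal.ofReal_coe_nnreal]
        refine mul_le_of_le_one_right zero_le ?_
        rw [ENNReal.ofReal_le_one]
        rcases lt_trichotomy (v t) 0 with h | h | h <;> simp [h]
      · simp [ht, h0]
    have hfin : ∫⁻ t in B N, (h N t : ℝ≥0∞) * V t ∂μ < ∞ := by
      calc ∫⁻ t in B N, (h N t : ℝ≥0∞) * V t ∂μ ≤ ∫⁻ _ in B N, (C : ℝ≥0∞) * N ∂μ := by
            refine setLIntegral_mono measurable_const fun t ht => ?_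
            have h3 : ((V t : ℝ≥0) : ℝ≥0∞) ≤ N := by exact_mod_cast ht.2
            gcongr
            exact hC t
        _ = C * N * μ (B N) := setLIntegral_const _ _
        _ < ∞ := ENNReal.mul_lt_top (ENNReal.mul_lt_top ENNReal.coe_lt_top
            (ENNReal.natCast_lt_top N)) (lt_of_le_of_lt (measure_mono Set.inter_subset_left)
              (measure_spanningSets_lt_top μ N))
    -- By `h1` the subtraction in `G` is not truncated, so it can be undone under the integral.
    have hsplit : ∫⁻ t in B N, (h N t : ℝ≥0∞) * V t ∂μ =
        ∫⁻ t, G N t ∂μ + ∫⁻ t in B N, Φ.toFun t (h N t) ∂μ := by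
      rw [hG, lintegral_indicator (hBm N), ← lintegral_add_right' _ (hΦm N).restrict]
      refine lintegral_congr_ae (ae_restrict_of_ae ?_)
      filter_upwards [h1 N] with t h
      exact (tsub_add_cancel_of_le h).symm
    have hIΦ : ∫⁻ t in B N, Φ.toFun t (h N t) ∂μ < ∞ :=
      lt_of_le_of_lt (by rw [hsplit]; exact le_add_self) hfin
    have hmodlt := hmod.trans_lt hIΦ
    have hint := Φ.integrable_mul ⟨1, one_pos, by rwa [one_smul]⟩ hv
    have hint_eq : ENNReal.ofReal (∫ t, u t * v t ∂μ) =
        ∫⁻ t in B N, (h N t : ℝ≥0∞) * V t ∂μ := by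
      rw [ofReal_integral_eq_lintegral_ofReal hint, ← lintegral_indicator (hBm N)]
      · refine lintegral_congr_ae ?_
        filter_upwards [hprod] with t e
        rw [e]
        by_cases ht : t ∈ B N
        · simp only [Set.indicator_of_mem ht]
          rw [ENNReal.ofReal_mul NNReal.zero_le_coe, ENNReal.ofReal_coe_nnreal,
            ENNReal.ofReal_coe_nnreal]
        · simp [ht]
      · filter_upwards [hprod] with t e
        rw [e]
        exact Set.indicator_nonneg (fun _ _ => by positivity) t
    have hle := ENNReal.ofReal_le_ofReal (hM u hmodlt)
    rw [hint_eq, hsplit, ENNReal.ofReal_add hM0 ENNReal.toReal_nonneg,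
      ENNReal.ofReal_toReal hmodlt.ne] at hle
    exact (ENNReal.add_le_add_iff_right hIΦ.ne).1 (hle.trans (by gcongr))
  -- Each point lies in `B N` for large `N`, and `h N` is at least as good as every `q k` with `k <
  -- N`. Hence the lower limit of `G N` dominates the conjugate, and Fatou's lemma applies.
  calc modular μ (conj Φ.toFun) v ≤ ∫⁻ t, liminf (fun N => G N t) atTop ∂μ := by
        refine lintegral_mono_ae ?_
        filter_upwards [Φ.conj_le_iSup (TopologicalSpace.denseRange_denseSeq ℝ≥0),
          ae_all_iff.2 h2] with t hle h2
        refine (hle (V t)).trans (iSup_le fun k => ?_)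
        refine le_liminf_of_le (by isBoundedDefault) ?_
        obtain ⟨n, hn⟩ := exists_nat_ge (V t)
        filter_upwards [eventually_gt_atTop k, eventually_ge_atTop (spanningSetsIndex μ t),
          eventually_ge_atTop n] with N hk hN hVN
        have ht : t ∈ B N := ⟨mem_spanningSets_of_index_le μ t hN,
          hn.trans (by exact_mod_cast hVN)⟩
        simp only [hG, Set.indicator_of_mem ht]
        exact h2 N k hk
    _ ≤ liminf (fun N => ∫⁻ t, G N t ∂μ) atTop := lintegral_liminf_le' hGm
    _ ≤ ENNReal.ofReal M :=
        liminf_le_of_le (by isBoundedDefault) fun b hb => by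
          obtain ⟨N, hN⟩ := hb.exists
          exact hN.trans (hGle N)

end MusielakOrliczFunction

/-! ### The unit ball of the dual -/

namespace OrliczSpace

variable {Φ : MusielakOrliczFunction μ}

theorem setIntegral_abs_le {E : Set T} {k : T → ℝ} {g : T → ℝ≥0∞}
    {ε : ℝ} (hε : 0 ≤ ε) (hkg : ∀ t, ENNReal.ofReal |k t| ≤ g t)
    (hg : ∫⁻ t in E, g t ∂μ ≤ ENNReal.ofReal ε) : |∫ t in E, k t ∂μ| ≤ ε := by
  have h := norm_integral_le_lintegral_norm (μ := μ.restrict E) k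
  rw [Real.norm_eq_abs] at h
  refine h.trans (ENNReal.toReal_le_of_le_ofReal hε (le_trans ?_ hg))
  exact lintegral_mono hkg

theorem memSpace_smul {Ψ : T → ℝ≥0∞ → ℝ≥0∞} {v : T →ₘ[μ] ℝ} (hv : MemSpace μ Ψ v) {c : ℝ}
    (hc : 0 < c) : MemSpace μ Ψ (c • v) := by
  obtain ⟨a, ha, h⟩ := hv
  refine ⟨a / c, by positivity, ?_⟩
  rwa [smul_smul, div_mul_cancel₀ _ hc.ne']

/-- The modulus of an element of `L₀^Φ`. -/
noncomputable def abs (u : OrliczSpace Φ) : OrliczSpace Φ :=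
  ⟨|u.toAEEqFun|, Φ.memSpace_of_le u.memSpace (by
    filter_upwards [AEEqFun.coeFn_abs u.toAEEqFun] with t h
    rw [h, abs_abs])⟩

theorem abs_ae (u : OrliczSpace Φ) : ∀ᵐ t ∂μ, u.abs.toAEEqFun t = |u.toAEEqFun t| :=
  AEEqFun.coeFn_abs u.toAEEqFun

variable [SigmaFinite μ]

/-- The singular part is replaced, near a given `u`, by integration against a multiple of a
near-extremal function on `E`. The sum of the two budgets `I_{Φ*}(v)` and `‖s‖` then bounds the
modular of a single competitor in the Orlicz norm of `u`. -/
theorem norm_le_one_of_conj_modular_add_le {v : T →ₘ[μ] ℝ} (hv : MemSpace μ (conj Φ.toFun) v)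
    {s : StrongDual ℝ (OrliczSpace Φ)} (hs : IsTailFunctional s)
    (h : modular μ (conj Φ.toFun) v + ENNReal.ofReal ‖s‖ ≤ 1) :
    ‖integralFunctional Φ v hv + s‖ ≤ 1 := by
  have hs1 : ‖s‖ ≤ 1 := by
    rw [← ENNReal.ofReal_le_one]
    exact le_add_self.trans h
  have key : ∀ u : OrliczSpace Φ, (integralFunctional Φ v hv + s) u ≤ ‖u‖ := by
    intro u
    refine le_of_forall_pos_le_add fun δ hδ => ?_
    obtain ⟨ε, hε, rfl⟩ : ∃ ε : ℝ, 0 < ε ∧ 4 * ε = δ := ⟨δ / 4, by positivity, by ring⟩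
    have huv := Φ.integrable_mul u.memSpace hv
    obtain ⟨E, hE, hgE, hsE⟩ := hs u.abs (fun t => ENNReal.ofReal |u.toAEEqFun t * v t|) ε
      (by filter_upwards [u.abs_ae] with t e; rw [e]; positivity)
      huv.abs.aestronglyMeasurable.aemeasurable.ennreal_ofReal
      (by have := huv.2; rw [hasFiniteIntegral_iff_norm] at this; exact this.ne) hε
    have h1 : |s (restrict Eᶜ hE.compl u)| ≤ ε := by
      refine hsE _ ?_ ?_
      · filter_upwards [restrict_ae Eᶜ hE.compl u, u.abs_ae] with t e1 e2
        rw [e1, e2]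
        by_cases ht : t ∈ E <;> simp [ht]
      · filter_upwards [restrict_ae Eᶜ hE.compl u] with t e1 ht
        rw [e1]; simp [ht]
    have h2 : |∫ t in E, u.toAEEqFun t * v t ∂μ| ≤ ε :=
      setIntegral_abs_le hε.le (fun t => le_rfl) hgE
    set uE := restrict E hE u with huE
    have h3 : s uE ≤ ‖s‖ * ‖uE‖ := (le_abs_self _).trans (s.le_opNorm uE)
    -- A near-extremal `w` for the norm of `u 1_E`; its sign is adjusted below to drop the absolute
    -- value.
    obtain ⟨r, ⟨w, hw, rfl⟩, hr⟩ := exists_lt_of_lt_csSup (Φ.orliczSet_nonempty uE.toAEEqFun)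
      (show Φ.orliczNorm uE.toAEEqFun - ε < sSup (Φ.orliczSet uE.toAEEqFun) from
        sub_lt_self _ hε)
    rw [← norm_def, huE, integral_restrict] at hr
    obtain ⟨w', hw', hr'⟩ : ∃ w' : T →ₘ[μ] ℝ, modular μ (conj Φ.toFun) w' ≤ 1 ∧
        ‖uE‖ - ε < ∫ t in E, u.toAEEqFun t * w' t ∂μ := by
      rcases lt_abs.1 hr with hr | hr
      · exact ⟨w, hw, hr⟩
      · refine ⟨-w, by rwa [modular_conj_neg], hr.trans_eq ?_⟩
        rw [← integral_neg]
        refine integral_congr_ae (ae_restrict_of_ae ?_)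
        filter_upwards [AEEqFun.coeFn_neg w] with t e
        simp [e]
    have hsw : modular μ (conj Φ.toFun) (‖s‖ • w') ≤ ENNReal.ofReal ‖s‖ := by
      have h := modular_conj_smul_le Φ.toFun (c := ‖s‖) (by rwa [abs_norm]) w'
      rw [abs_norm] at h
      exact h.trans (mul_le_of_le_one_right zero_le hw')
    -- Contraction by `‖s‖ ≤ 1` makes the part on `E` cost at most `‖s‖`, and the part off `E` costs
    -- at most `I_{Φ*}(v)`.
    set y := glue E hE (‖s‖ • w') v with hy
    have hy1 : modular μ (conj Φ.toFun) y ≤ 1 := by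
      rw [hy, modular_glue, add_comm]
      refine le_trans (add_le_add (setLIntegral_le_lintegral _ _)
        ((setLIntegral_le_lintegral _ _).trans hsw)) h
    have h4 := (le_abs_self _).trans (Φ.le_orliczNorm u.memSpace hy1)
    have hswm : MemSpace μ (conj Φ.toFun) (‖s‖ • w') :=
      MusielakOrliczFunction.memSpace_of_modular_le_one
        (hsw.trans (by rwa [ENNReal.ofReal_le_one]))
    rw [hy, integral_glue hE _ _ _ (Φ.integrable_mul u.memSpace hswm) huv, ← norm_def] at h4
    have h5 : ∫ t in E, u.toAEEqFun t * (‖s‖ • w') t ∂μ =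
        ‖s‖ * ∫ t in E, u.toAEEqFun t * w' t ∂μ := by
      rw [← integral_const_mul]
      refine integral_congr_ae (ae_restrict_of_ae ?_)
      filter_upwards [AEEqFun.coeFn_smul ‖s‖ w'] with t e
      simp only [e, Pi.smul_apply, smul_eq_mul]
      ring
    rw [h5] at h4
    have h6 : s u = s uE + s (restrict Eᶜ hE.compl u) := by
      rw [← map_add, restrict_add_restrict_compl]
    have h7 := integral_add_compl hE huv
    have h8 : ‖s‖ * (‖uE‖ - ε) ≤ ‖s‖ * ∫ t in E, u.toAEEqFun t * w' t ∂μ := by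
      gcongr
    rw [add_apply, integralFunctional_apply, h6, ← h7]
    nlinarith [abs_le.1 h1, abs_le.1 h2, norm_nonneg s]
  refine ContinuousLinearMap.opNorm_le_bound _ zero_le_one fun u => ?_
  rw [one_mul, Real.norm_eq_abs, abs_le]
  refine ⟨?_, key u⟩
  have := key (-u)
  rw [map_neg, norm_neg] at this
  linarith

/-- For `‖z‖ ≤ 1`, the numbers `∫ z w dμ - I_{Φ*}(w)` are bounded by one. -/
theorem integral_mul_sub_conj_modular_le_one {z : OrliczSpace Φ} (hz : ‖z‖ ≤ 1) {w : T →ₘ[μ] ℝ}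
    (hw : modular μ (conj Φ.toFun) w ≠ ∞) :
    ∫ t, z.toAEEqFun t * w t ∂μ - (modular μ (conj Φ.toFun) w).toReal ≤ 1 := by
  rw [norm_def] at hz
  rcases le_total (modular μ (conj Φ.toFun) w) 1 with h1 | h1
  · have := (le_abs_self _).trans (Φ.le_orliczNorm z.memSpace h1)
    have := ENNReal.toReal_nonneg (a := modular μ (conj Φ.toFun) w)
    linarith
  · set m := (modular μ (conj Φ.toFun) w).toReal with hm
    have hm1 : 1 ≤ m := by
      rw [hm, ← ENNReal.toReal_one]
      exact ENNReal.toReal_mono hw h1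
    have hmi : |m⁻¹| ≤ 1 := by
      rw [abs_of_nonneg (by positivity)]
      exact inv_le_one_of_one_le₀ hm1
    -- With `m = I_{Φ*}(w) ≥ 1`, the function `w/m` is admissible for the Orlicz norm, so `∫ z w ≤
    -- m`.
    have h2 : modular μ (conj Φ.toFun) (m⁻¹ • w) ≤ 1 := by
      refine (modular_conj_smul_le Φ.toFun hmi w).trans ?_
      rw [← ENNReal.ofReal_toReal hw, ← hm, ← ENNReal.ofReal_mul (abs_nonneg _),
        abs_of_nonneg (by positivity), inv_mul_cancel₀ (by positivity), ENNReal.ofReal_one]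
    have h3 := ((le_abs_self _).trans (Φ.le_orliczNorm z.memSpace h2)).trans hz
    simp_rw [mul_comm (z.toAEEqFun _)] at h3 ⊢
    rw [MusielakOrliczFunction.integral_smul_mul, inv_mul_le_iff₀ (by positivity)] at h3
    linarith

/-- The functional is tested on `x`, equal to `z` on `E` and to `u` off `E`. Since `E` is small for
the relevant densities and `s` nearly ignores its complement, `f(x)` is close to `∫ u v + s(z)`; the
work lies in bounding `‖x‖`. -/
theorem integral_add_apply_le {v : T →ₘ[μ] ℝ} (hv : MemSpace μ (conj Φ.toFun) v)
    {s : StrongDual ℝ (OrliczSpace Φ)} (hs : IsTailFunctional s)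
    (h : ‖integralFunctional Φ v hv + s‖ ≤ 1) (u z : OrliczSpace Φ)
    (hu : modular μ Φ.toFun u.toAEEqFun < ∞) (hz : ‖z‖ ≤ 1) :
    ∫ t, u.toAEEqFun t * v t ∂μ + s z ≤ 1 + (modular μ Φ.toFun u.toAEEqFun).toReal := by
  refine le_of_forall_pos_le_add fun δ hδ => ?_
  obtain ⟨ε, hε, rfl⟩ : ∃ ε : ℝ, 0 < ε ∧ 6 * ε = δ := ⟨δ / 6, by positivity, by ring⟩
  set I := modular μ (conj Φ.toFun) with hI
  set A : Set ℝ := {r | ∃ w : T →ₘ[μ] ℝ, I w ≠ ∞ ∧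
    r = ∫ t, z.toAEEqFun t * w t ∂μ - (I w).toReal} with hA
  have hAb : BddAbove A := ⟨1, by
    rintro r ⟨w, hw, rfl⟩
    exact integral_mul_sub_conj_modular_le_one hz hw⟩
  have hAne : A.Nonempty := ⟨_, 0, by simp [hI, modular_conj_zero], rfl⟩
  -- Near-maximality of `w₀` is a global property that localizes: changing `w₀` on `E` alone can
  -- gain at most `ε`. It is chosen before `E`, so that `|z w₀|` can be part of the density made
  -- small on `E`.
  obtain ⟨_, ⟨w₀, hw₀, rfl⟩, hnear⟩ := exists_lt_of_lt_csSup hAne (sub_lt_self (sSup A) hε)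
  have hmem : ∀ {w : T →ₘ[μ] ℝ}, I w ≠ ∞ → MemSpace μ (conj Φ.toFun) w := fun hw =>
    ⟨1, one_pos, by rw [one_smul]; exact hw.lt_top⟩
  have huv := Φ.integrable_mul u.memSpace hv
  have hzv := Φ.integrable_mul z.memSpace hv
  have hzw₀ := Φ.integrable_mul z.memSpace (hmem hw₀)
  obtain ⟨E, hE, hgE, hsE⟩ := hs (u.abs + z.abs) (fun t => ENNReal.ofReal
      (|u.toAEEqFun t * v t| + |z.toAEEqFun t * v t| + |z.toAEEqFun t * w₀ t|)) ε
    (by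
      filter_upwards [u.abs_ae, z.abs_ae, toAEEqFun_add_ae u.abs z.abs] with t e1 e2 e3
      rw [e3, e1, e2]; positivity)
    ((huv.abs.add hzv.abs).add hzw₀.abs).aestronglyMeasurable.aemeasurable.ennreal_ofReal
    (by
      have := ((huv.abs.add hzv.abs).add hzw₀.abs).2
      rw [hasFiniteIntegral_iff_ofReal (ae_of_all _ fun t => by
        simp only [Pi.add_apply]; positivity)] at this
      exact this.ne) hε
  have hres : ∀ x : OrliczSpace Φ, (∀ᵐ t ∂μ, |x.toAEEqFun t| ≤
      |u.toAEEqFun t| + |z.toAEEqFun t|) → |s (restrict Eᶜ hE.compl x)| ≤ ε := by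
    intro x hx
    refine hsE _ ?_ ?_
    · filter_upwards [restrict_ae Eᶜ hE.compl x, u.abs_ae, z.abs_ae,
        toAEEqFun_add_ae u.abs z.abs, hx] with t e1 e2 e3 e4 hx
      rw [e1, e4, e2, e3]
      by_cases ht : t ∈ E
      · simp only [Set.mem_compl_iff, ht, not_true_eq_false, not_false_eq_true,
          Set.indicator_of_notMem, abs_zero]
        positivity
      · simpa [ht] using hx
    · filter_upwards [restrict_ae Eᶜ hE.compl x] with t e1 ht
      rw [e1]; simp [ht]
  have h1 := hres u (ae_of_all _ fun t => le_add_of_nonneg_right (abs_nonneg _))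
  have h2 := hres z (ae_of_all _ fun t => le_add_of_nonneg_left (abs_nonneg _))
  have h3 : |∫ t in E, u.toAEEqFun t * v t ∂μ| ≤ ε := setIntegral_abs_le hε.le
    (fun t => ENNReal.ofReal_le_ofReal (by
      have := abs_nonneg (z.toAEEqFun t * v t)
      have := abs_nonneg (z.toAEEqFun t * w₀ t)
      linarith)) hgE
  have h4 : |∫ t in E, z.toAEEqFun t * v t ∂μ| ≤ ε := setIntegral_abs_le hε.le
    (fun t => ENNReal.ofReal_le_ofReal (by
      have := abs_nonneg (u.toAEEqFun t * v t)
      have := abs_nonneg (z.toAEEqFun t * w₀ t)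
      linarith)) hgE
  have h5 : |∫ t in E, z.toAEEqFun t * w₀ t ∂μ| ≤ ε := setIntegral_abs_le hε.le
    (fun t => ENNReal.ofReal_le_ofReal (by
      have := abs_nonneg (u.toAEEqFun t * v t)
      have := abs_nonneg (z.toAEEqFun t * v t)
      linarith)) hgE
  set x := restrict E hE z + restrict Eᶜ hE.compl u with hx
  have hxw : ∀ w : T →ₘ[μ] ℝ, MemSpace μ (conj Φ.toFun) w →
      ∫ t, x.toAEEqFun t * w t ∂μ =
        ∫ t in E, z.toAEEqFun t * w t ∂μ + ∫ t in Eᶜ, u.toAEEqFun t * w t ∂μ := by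
    intro w hw
    rw [← integral_restrict E hE z, ← integral_restrict Eᶜ hE.compl u,
      ← integral_add (Φ.integrable_mul (memSpace _) hw) (Φ.integrable_mul (memSpace _) hw)]
    refine integral_congr_ae ?_
    filter_upwards [toAEEqFun_add_ae (restrict E hE z) (restrict Eᶜ hE.compl u)] with t e
    rw [hx, e, add_mul]
  -- the Orlicz norm of `x` is almost bounded by `1 + I_Φ(u)`
  have hxn : ∀ w : T →ₘ[μ] ℝ, I w ≤ 1 → ∫ t, x.toAEEqFun t * w t ∂μ ≤
      1 + (modular μ Φ.toFun u.toAEEqFun).toReal + 2 * ε := by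
    intro w hw
    have hwt : I w ≠ ∞ := ne_top_of_le_ne_top ENNReal.one_ne_top hw
    have huw := Φ.integrable_mul u.memSpace (hmem hwt)
    have hzw := Φ.integrable_mul z.memSpace (hmem hwt)
    have hsp : ∀ w : T →ₘ[μ] ℝ, ∫⁻ t in E, conj Φ.toFun t (ENNReal.ofReal |w t|) ∂μ +
        ∫⁻ t in Eᶜ, conj Φ.toFun t (ENNReal.ofReal |w t|) ∂μ = I w := fun w =>
      lintegral_add_compl _ hE
    set p := ∫⁻ t in E, conj Φ.toFun t (ENNReal.ofReal |w t|) ∂μ with hp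
    set p' := ∫⁻ t in Eᶜ, conj Φ.toFun t (ENNReal.ofReal |w t|) ∂μ with hp'
    set r := ∫⁻ t in E, conj Φ.toFun t (ENNReal.ofReal |w₀ t|) ∂μ with hr
    set r' := ∫⁻ t in Eᶜ, conj Φ.toFun t (ENNReal.ofReal |w₀ t|) ∂μ with hr'
    have hpp : p + p' = I w := hsp w
    have hrr : r + r' = I w₀ := hsp w₀
    obtain ⟨hpt, hpt'⟩ := ENNReal.add_ne_top.1 (hpp ▸ hwt)
    obtain ⟨hrt, hrt'⟩ := ENNReal.add_ne_top.1 (hrr ▸ hw₀)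
    have hIg : I (glue E hE w w₀) = p + r' := modular_glue hE w w₀ _
    -- Comparing `w₀` with its modification by `w` on `E` bounds `∫_E z w` by `I_E(w) + 2ε`, where
    -- `I_E` is the part of the modular over `E`. Young's inequality off `E` supplies the remaining
    -- part of `I(w) ≤ 1`.
    have ha := le_csSup hAb ⟨glue E hE w w₀,
      by rw [hIg]; exact ENNReal.add_ne_top.2 ⟨hpt, hrt'⟩, rfl⟩
    rw [hIg, integral_glue hE _ _ _ hzw hzw₀, ENNReal.toReal_add hpt hrt'] at ha
    have hs₀ := integral_add_compl hE hzw₀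
    have hIw₀ : (I w₀).toReal = r.toReal + r'.toReal := by
      rw [← hrr, ENNReal.toReal_add hrt hrt']
    have hpp1 : p.toReal + p'.toReal ≤ 1 := by
      rw [← ENNReal.toReal_add hpt hpt', hpp, ← ENNReal.toReal_one]
      exact ENNReal.toReal_mono ENNReal.one_ne_top hw
    have hyoung : ∫ t in Eᶜ, u.toAEEqFun t * w t ∂μ ≤
        (modular μ Φ.toFun u.toAEEqFun).toReal + p'.toReal := by
      refine (le_abs_self _).trans ?_
      have h := norm_integral_le_lintegral_norm (μ := μ.restrict Eᶜ)
        (fun t => u.toAEEqFun t * w t)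
      rw [Real.norm_eq_abs] at h
      rw [← ENNReal.toReal_add hu.ne hpt']
      refine h.trans (ENNReal.toReal_mono (ENNReal.add_ne_top.2 ⟨hu.ne, hpt'⟩) ?_)
      calc ∫⁻ t in Eᶜ, ENNReal.ofReal ‖u.toAEEqFun t * w t‖ ∂μ
          ≤ ∫⁻ t in Eᶜ, (Φ.toFun t (ENNReal.ofReal |u.toAEEqFun t|) +
              conj Φ.toFun t (ENNReal.ofReal |w t|)) ∂μ := lintegral_mono fun t => Φ.young t _ _
        _ = ∫⁻ t in Eᶜ, Φ.toFun t (ENNReal.ofReal |u.toAEEqFun t|) ∂μ + p' :=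
            lintegral_add_left' (Φ.aemeasurable_abs u.toAEEqFun).restrict _
        _ ≤ _ := by
            gcongr
            exact setLIntegral_le_lintegral _ _
    rw [hxw w (hmem hwt)]
    have := ENNReal.toReal_nonneg (a := r)
    linarith [abs_le.1 h5]
  have hxnorm : ‖x‖ ≤ 1 + (modular μ Φ.toFun u.toAEEqFun).toReal + 2 * ε := by
    rw [norm_def]
    refine csSup_le (Φ.orliczSet_nonempty _) ?_
    rintro _ ⟨w, hw, rfl⟩
    refine abs_le'.2 ⟨hxn w hw, ?_⟩
    have := hxn (-w) (by rwa [hI, modular_conj_neg])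
    rw [← integral_neg]
    refine le_trans (le_of_eq (integral_congr_ae ?_)) this
    filter_upwards [AEEqFun.coeFn_neg w] with t e
    simp [e]
  have hfx : (integralFunctional Φ v hv + s) x ≤ ‖x‖ := by
    refine (le_abs_self _).trans (((integralFunctional Φ v hv + s).le_opNorm x).trans ?_)
    exact mul_le_of_le_one_left (norm_nonneg _) h
  rw [add_apply, integralFunctional_apply, hxw v hv, hx, map_add] at hfx
  have h6 : s z = s (restrict E hE z) + s (restrict Eᶜ hE.compl z) := by
    rw [← map_add, restrict_add_restrict_compl]
  have h7 := integral_add_compl hE huv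
  rw [← hx] at hfx
  -- Passing from `f(x)` to `∫ u v + s(z)` costs `ε` for each of the four small terms; with the `2ε`
  -- in `‖x‖` this makes `6ε`.
  linarith [abs_le.1 h1, abs_le.1 h2, abs_le.1 h3, abs_le.1 h4]

theorem conj_modular_add_le_one_of_norm_le {v : T →ₘ[μ] ℝ} (hv : MemSpace μ (conj Φ.toFun) v)
    {s : StrongDual ℝ (OrliczSpace Φ)} (hs : IsTailFunctional s)
    (h : ‖integralFunctional Φ v hv + s‖ ≤ 1) :
    modular μ (conj Φ.toFun) v + ENNReal.ofReal ‖s‖ ≤ 1 := by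
  have key : ∀ u : T →ₘ[μ] ℝ, modular μ Φ.toFun u < ∞ →
      ∫ t, u t * v t ∂μ + ‖s‖ ≤ 1 + (modular μ Φ.toFun u).toReal := by
    intro u hu
    have hum : MemSpace μ Φ.toFun u := ⟨1, one_pos, by rwa [one_smul]⟩
    have hz := integral_add_apply_le hv hs h ⟨u, hum⟩ (hu := hu)
    change ∀ z, _ → ∫ t, u t * v t ∂μ + s z ≤ 1 + (modular μ Φ.toFun u).toReal at hz
    -- The case `z = 0` gives the non-negativity required of an operator norm bound.
    have h0 := hz 0 (by simp)
    rw [map_zero] at h0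
    have : ‖s‖ ≤ 1 + (modular μ Φ.toFun u).toReal - ∫ t, u t * v t ∂μ := by
      refine ContinuousLinearMap.opNorm_le_of_unit_norm (by linarith) fun z hz1 => ?_
      have h1 := hz z hz1.le
      have h2 := hz (-z) (by rw [norm_neg, hz1])
      rw [map_neg] at h2
      rw [Real.norm_eq_abs, abs_le]
      constructor <;> linarith
    linarith
  have hmain := Φ.modular_conj_le hv (M := 1 - ‖s‖) fun u hu => by linarith [key u hu]
  -- Taking `u = 0` yields `‖s‖ ≤ 1`, so `ENNReal.ofReal (1 - ‖s‖)` is not truncated.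
  have h0 := key 0 (by simp [Φ.modular_zero])
  have hz : ∫ t, (0 : T →ₘ[μ] ℝ) t * v t ∂μ = 0 := by
    rw [integral_congr_ae (g := fun _ => 0)]
    · simp
    · filter_upwards [AEEqFun.coeFn_zero (α := T) (μ := μ) (β := ℝ)] with t h
      simp [h]
  rw [hz, Φ.modular_zero] at h0
  simp only [zero_add, ENNReal.toReal_zero, add_zero] at h0
  calc _ ≤ ENNReal.ofReal (1 - ‖s‖) + ENNReal.ofReal ‖s‖ := by gcongr
    _ = 1 := by
        rw [← ENNReal.ofReal_add (by linarith) (norm_nonneg _)]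
        simp

theorem smul_integralFunctional {v : T →ₘ[μ] ℝ} (hv : MemSpace μ (conj Φ.toFun) v) {c : ℝ}
    (hc : 0 < c) : c • integralFunctional Φ v hv =
      integralFunctional Φ (c • v) (memSpace_smul hv hc) := by
  ext u
  change c * ∫ t, u.toAEEqFun t * v t ∂μ = ∫ t, u.toAEEqFun t * (c • v) t ∂μ
  simp_rw [mul_comm (u.toAEEqFun _)]
  exact (MusielakOrliczFunction.integral_smul_mul c v _).symm

theorem norm_le_iff_conj_modular_add_le_one {v : T →ₘ[μ] ℝ}
    (hv : MemSpace μ (conj Φ.toFun) v) {s : StrongDual ℝ (OrliczSpace Φ)}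
    (hs : IsTailFunctional s) {lam : ℝ} (hlam : 0 < lam) :
    ‖integralFunctional Φ v hv + s‖ ≤ lam ↔
      modular μ (conj Φ.toFun) (lam⁻¹ • v) + ENNReal.ofReal ‖lam⁻¹ • s‖ ≤ 1 := by
  have hinv : 0 < lam⁻¹ := inv_pos.2 hlam
  have e : ‖integralFunctional Φ v hv + s‖ ≤ lam ↔
      ‖integralFunctional Φ (lam⁻¹ • v) (memSpace_smul hv hinv) + lam⁻¹ • s‖ ≤ 1 := by
    rw [← smul_integralFunctional hv hinv, ← smul_add, norm_smul, Real.norm_eq_abs,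
      abs_of_pos hinv, inv_mul_le_iff₀ hlam, mul_one]
  rw [e]
  exact ⟨conj_modular_add_le_one_of_norm_le _ (hs.smul _),
    norm_le_one_of_conj_modular_add_le _ (hs.smul _)⟩

end OrliczSpace

end MusielakOrlicz

/-! ### The norm formula -/

theorem mainTheorem7 {T : Type*} [MeasurableSpace T] (μ : MeasureTheory.Measure T)
    [MeasureTheory.SigmaFinite μ] (hμ : MusielakOrlicz.IsNonatomic μ)
    (Φ : MusielakOrlicz.MusielakOrliczFunction μ)
    (f fs : StrongDual ℝ (MusielakOrlicz.OrliczSpace Φ)) (v : T →ₘ[μ] ℝ)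
    (hv : MusielakOrlicz.MemSpace μ (MusielakOrlicz.conj Φ.toFun) v)
    (hfs : MusielakOrlicz.OrliczSpace.IsPurelySingular fs)
    (hf : f = MusielakOrlicz.OrliczSpace.integralFunctional Φ v hv + fs) :
    {lam : ℝ | 0 < lam ∧
      MusielakOrlicz.modular μ (MusielakOrlicz.conj Φ.toFun) (lam⁻¹ • v)
        + ENNReal.ofReal ‖lam⁻¹ • fs‖ ≤ 1}.Nonempty ∧
    ‖f‖ = sInf {lam : ℝ | 0 < lam ∧
      MusielakOrlicz.modular μ (MusielakOrlicz.conj Φ.toFun) (lam⁻¹ • v)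
        + ENNReal.ofReal ‖lam⁻¹ • fs‖ ≤ 1} := by
  subst hf
  have hs := hfs.isTailFunctional
  set f := MusielakOrlicz.OrliczSpace.integralFunctional Φ v hv + fs with hf
  have hset : {lam : ℝ | 0 < lam ∧
      MusielakOrlicz.modular μ (MusielakOrlicz.conj Φ.toFun) (lam⁻¹ • v)
        + ENNReal.ofReal ‖lam⁻¹ • fs‖ ≤ 1} = {lam : ℝ | 0 < lam ∧ ‖f‖ ≤ lam} := by
    ext lam
    exact and_congr_right fun hlam =>
      (MusielakOrlicz.OrliczSpace.norm_le_iff_conj_modular_add_le_one hv hs hlam).symm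
  -- The points `‖f‖ + ε` are used because `‖f‖` itself is excluded from the set when it is `0`.
  have hmem : ∀ ε : ℝ, 0 < ε → ‖f‖ + ε ∈ {lam : ℝ | 0 < lam ∧ ‖f‖ ≤ lam} := fun ε hε =>
    ⟨by positivity, by linarith⟩
  rw [hset]
  refine ⟨⟨_, hmem 1 one_pos⟩, le_antisymm (le_csInf ⟨_, hmem 1 one_pos⟩ fun _ h => h.2) ?_⟩
  exact le_of_forall_pos_le_add fun ε hε => csInf_le ⟨‖f‖, fun _ h => h.2⟩ (hmem ε hε)
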